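/- **Setting.** Let $A=(a_{i,j})\in\mathbb{Z}^{d\times n}$ have nonzero columns $\mathbf a_1,\dots,\mathbf a_n$ with $\mathbb{Z}A=\mathbb{Z}^d$, and assume that the semigroup $\mathbb{N}A$ is positive, i.e. $0$ is the only $v\in\mathbb{N}A$ with $-v\in\mathbb{N}A$. Let $L=(L_1,\dots,L_n)\in\mathbb{Q}^n$, and let $R=\mathbb{C}[\partial_1,\dots,\partial_n]$, $\operatorname{Spec}(R)=\mathbb{C}^n$, be $\mathbb{Z}^d$-graded by $\deg\partial_j=\mathbf a_j$. *Toric ideals.* For $\tau\subseteq\{1,\dots,n\}$ let $I_\tau\subseteq\mathbb{C}[\partial_j: j\in\tau]$ be the ideal generated by all $\partial^{u_+}-\partial^{u_-}$ with $u\in\mathbb{Z}^\tau$, $\sum_{j\in\tau}u_j\mathbf a_j=0$, where $u_+=\max(u,0)$ and $u_-=u_+-u$. Put $I_A^\tau=R\,I_\tau+\langle\partial_j: j\notin\tau\rangle$, $I_A=I_{\{1,\dots,n\}}$ and $S_A=R/I_A$. Let $L_kR$ be the span of the monomials $\partial^u$ with $L\cdot u\le k$ $(k\in\mathbb{Q})$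 and let $L_kS_A$ be its image in $S_A$. Identify $\operatorname{gr}^L(R)$ with $R$ by sending the class of $f\in L_kR$ to its component of $L$-degree $k$. Let $I_A^L=\operatorname{gr}^L(I_A)\subseteq R$ and $S_A^L=\operatorname{gr}^L(S_A)$. *Orbits.* The torus $(\mathbb{C}^*)^d$ acts on $\mathbb{C}^n$ by $t\cdot\xi=(t^{\mathbf a_1}\xi_1,\dots,t^{\mathbf a_n}\xi_n)$. Let $O_A^\tau$ be the orbit of the indicator vector of $\tau$, and let a bar denote Zariski closure in $\mathbb{C}^n$. *Umbrella.* Embed $\mathbb{Q}^d\subseteq\mathbb{P}^d_{\mathbb{Q}}$ by $q\mapsto(q:1)$ and let $\mathbf a_j^L=\mathbf a_j/L_j$, which means the point at infinity $(\mathbf a_j:0)$ if $L_j=0$. Choose a linear form $h$ on $\mathbb{Q}^d$ with $h(\mathbf a_j)>0$ for all $j$ and a rational $\varepsilon>0$ with $\varepsilon<|h(\mathbf a_j)/L_j|$ whenever $L_j\neq0$. Let $H_\varepsilon=\{(q:s)\mid h(q)+\varepsilon s=0\}$ be the projective closure of $h^{-1}(-\varepsilon)$, and let $\Delta_A^L$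 be the convex hull of $\{0,\mathbf a_1^L,\dots,\mathbf a_n^L\}$ in the affine space $\mathbb{P}^d_{\mathbb{Q}}\setminus H_\varepsilon$. The umbrella $\Phi_A^L$ is the set of faces of $\Delta_A^L$ (including the empty face) that do not contain $0$. A face $\tau$ is identified with $\{j\mid\mathbf a_j^L\in\tau\}$, and its dimension is $\dim_{\mathbb{Q}}\operatorname{span}_{\mathbb{Q}}\{\mathbf a_j\mid j\in\tau\}-1$. Let $\Phi_A^{L,d-1}$ be the set of faces in $\Phi_A^L$ of dimension $d-1$ (the facets). **Theorem.** For every such choice of $h$ and $\varepsilon$: 1. The set of $\mathbb{Z}^d$-graded prime ideals of $R$ containing $I_A^L$ equals $\{I_A^\tau\mid\tau\in\Phi_A^L\}$. 2. The canonical map $R=\operatorname{gr}^L(R)\to S_A^L$ is surjective with kernel $I_A^L$, so that $\operatorname{Spec}(S_A^L)=\operatorname{Var}(I_A^L)\subseteq\mathbb{C}^n$, and $$\operatorname{Spec}(S_A^L)=\operatorname{Var}(I_A^L)=\bigcup_{\tau\in\Phi_A^{L,d-1}}\overline{O_A^\tau}=\bigsqcup_{\tau\in\Phi_A^L}O_A^\tau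 ,$$ the last union being disjoint. 3. For all $\tau,\tau'\in\Phi_A^L$: $O_A^{\tau'}\subseteq\overline{O_A^\tau}$ if and only if $\tau'\subseteq\tau$ (as faces, equivalently as index sets). -/

import Mathlib

noncomputable section

namespace GKZ

open scoped LinearAlgebra.Projectivization

/-! ### Associated graded ring of a filtered commutative algebra -/

section AssociatedGraded

variable {S : Type*} [CommRing S] [Algebra ℂ S]

/-- `F_{<k} = ⋃_{i < k} F_i` (for an increasing filtration the union is the supremum). -/
def filtLT (F : ℚ → Submodule ℂ S) (k : ℚ) : Submodule ℂ S := ⨆ i : Set.Iio k, F i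

theorem mul_mem_filtLT (F : ℚ → Submodule ℂ S) [SetLike.GradedMonoid F] {i j : ℚ} {a b : S}
    (ha : a ∈ F i) (hb : b ∈ filtLT F j) : a * b ∈ filtLT F (i + j) := by
  have h : filtLT F j ≤ (filtLT F (i + j)).comap (LinearMap.mulLeft ℂ a) := by
    refine iSup_le fun m x hx => ?_
    have hm : i + (m : ℚ) ∈ Set.Iio (i + j) := by
      have := m.2
      simp only [Set.mem_Iio] at this ⊢
      linarith
    exact Submodule.mem_iSup_of_mem (p := fun n : Set.Iio (i + j) => F n) ⟨i + m, hm⟩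
      (SetLike.mul_mem_graded ha hx)
  exact h hb

/-- The Rees algebra of `F`: the finite sums `∑ s_k T^k` with `s_k ∈ F_k`. -/
def rees (F : ℚ → Submodule ℂ S) [SetLike.GradedMonoid F] :
    Subalgebra ℂ (AddMonoidAlgebra S ℚ) where
  carrier := {f | ∀ k, f.coeff k ∈ F k}
  mul_mem' {f g} hf hg k := by
    classical
    rw [AddMonoidAlgebra.coeff_mul]
    refine Submodule.sum_mem _ fun i _ => Submodule.sum_mem _ fun j _ => ?_
    dsimp only
    split_ifs with h
    · exact h ▸ SetLike.mul_mem_graded (hf i) (hg j)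
    · exact Submodule.zero_mem _
  add_mem' {f g} hf hg k := by
    rw [AddMonoidAlgebra.coeff_add]
    exact Submodule.add_mem _ (hf k) (hg k)
  algebraMap_mem' c k := by
    classical
    rw [AddMonoidAlgebra.coe_algebraMap, Function.comp_apply, AddMonoidAlgebra.coeff_single,
      Finsupp.single_apply]
    split_ifs with h
    · subst h
      rw [Algebra.algebraMap_eq_smul_one]
      exact Submodule.smul_mem _ _ SetLike.GradedOne.one_mem
    · exact Submodule.zero_mem _

/-- The sums `∑ s_k T^k` with `s_k ∈ F_{<k}`, an ideal of the Rees algebra. -/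
def reesLT (F : ℚ → Submodule ℂ S) [SetLike.GradedMonoid F] : Ideal (rees F) where
  carrier := {f | ∀ k, f.1.coeff k ∈ filtLT F k}
  add_mem' {f g} hf hg k := by
    change (f.1 + g.1).coeff k ∈ _
    rw [AddMonoidAlgebra.coeff_add]
    exact Submodule.add_mem _ (hf k) (hg k)
  zero_mem' k := Submodule.zero_mem _
  smul_mem' f g hg k := by
    classical
    change (f.1 * g.1).coeff k ∈ _
    rw [AddMonoidAlgebra.coeff_mul]
    refine Submodule.sum_mem _ fun i _ => Submodule.sum_mem _ fun j _ => ?_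
    dsimp only
    split_ifs with h
    · exact h ▸ mul_mem_filtLT F (f.2 i) (hg j)
    · exact Submodule.zero_mem _

/-- The associated graded ring `gr^F(S) = ⊕_k F_k / F_{<k}`, with the product
`(a mod F_{<i}) (b mod F_{<j}) = ab mod F_{<i+j}`: the degree-`k` coefficient of a class in the
quotient below is an element of `F_k` modulo `F_{<k}`. -/
abbrev Gr (F : ℚ → Submodule ℂ S) [SetLike.GradedMonoid F] : Type _ := rees F ⧸ reesLT F

/-- The class in `F_k / F_{<k}`, viewed in `gr^F(S)`, of an element `s ∈ F_k`. -/
def Gr.cls (F : ℚ → Submodule ℂ S) [SetLike.GradedMonoid F] (k : ℚ) (s : S) (hs : s ∈ F k) :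
    Gr F :=
  Ideal.Quotient.mk (reesLT F) ⟨AddMonoidAlgebra.single k s, fun m => by
    classical
    rw [AddMonoidAlgebra.coeff_single, Finsupp.single_apply]
    split_ifs with h
    · exact h ▸ hs
    · exact Submodule.zero_mem _⟩

end AssociatedGraded

/-! ### Toric ideals and toric rings -/

/-- The binomial `□_u = ∂^{u₊} - ∂^{u₋}`. -/
def box {ι : Type*} [Fintype ι] (u : ι → ℤ) : MvPolynomial ι ℂ :=
  (∏ j, MvPolynomial.X j ^ (u j).toNat) - ∏ j, MvPolynomial.X j ^ (-u j).toNat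

/-- The toric ideal of the integer matrix `A`, with columns indexed by `ι`. -/
def toricIdeal {d : ℕ} {ι : Type*} [Fintype ι] (A : Matrix (Fin d) ι ℤ) :
    Ideal (MvPolynomial ι ℂ) :=
  Ideal.span {f | ∃ u : ι → ℤ, A.mulVec u = 0 ∧ f = box u}

variable {d n : ℕ}

/-- The submatrix of `A` on the columns with index in `τ`. -/
def colsSubmatrix (A : Matrix (Fin d) (Fin n) ℤ) (τ : Finset (Fin n)) : Matrix (Fin d) τ ℤ :=
  A.submatrix id Subtype.val

/-- `I_A^τ = R I_τ + J_τ`, where `I_τ ⊆ ℂ[∂_τ]` is the toric ideal of `τ` and `J_τ` is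
generated by the `∂_j` with `j ∉ τ`. -/
def faceIdeal (A : Matrix (Fin d) (Fin n) ℤ) (τ : Finset (Fin n)) :
    Ideal (MvPolynomial (Fin n) ℂ) :=
  (toricIdeal (colsSubmatrix A τ)).map
      (MvPolynomial.rename (R := ℂ) (Subtype.val : τ → Fin n)).toRingHom ⊔
    Ideal.span {f | ∃ j, j ∉ τ ∧ f = MvPolynomial.X j}

/-- `P` is a graded ideal for the `ℤ^d`-grading on `R = ℂ[∂_1, …, ∂_n]` in which `∂_j` has
degree the `j`-th column of `A`. -/
def IsGradedIdeal (A : Matrix (Fin d) (Fin n) ℤ) (P : Ideal (MvPolynomial (Fin n) ℂ)) : Prop :=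
  letI := MvPolynomial.weightedGradedAlgebra ℂ A.col
  P.IsHomogeneous (MvPolynomial.weightedHomogeneousSubmodule ℂ A.col)

/-! ### The filtration by a weight vector -/

/-- `L_k R`, the span of the monomials `∂^u` with `L ⬝ u ≤ k`. -/
def weightFilt (L : Fin n → ℚ) (k : ℚ) : Submodule ℂ (MvPolynomial (Fin n) ℂ) :=
  Submodule.span ℂ {f | ∃ u : Fin n →₀ ℕ, Finsupp.weight L u ≤ k ∧ f = MvPolynomial.monomial u 1}

/-- The ideal `I^L = gr^L(I)` of `gr^L(R) = R`: it is generated by the classes modulo `L_{<k} R`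
of the elements of `I ∩ L_k R`, and the class of `f ∈ L_k R` is identified with
the component of `f` of `L`-degree `k`. -/
def gradedIdeal (L : Fin n → ℚ) (I : Ideal (MvPolynomial (Fin n) ℂ)) :
    Ideal (MvPolynomial (Fin n) ℂ) :=
  Ideal.span {g | ∃ k : ℚ, ∃ f ∈ I, f ∈ weightFilt L k ∧
    g = MvPolynomial.weightedHomogeneousComponent L k f}

/-- The toric ring `S_A = R / I_A`. -/
abbrev ToricRing (A : Matrix (Fin d) (Fin n) ℤ) : Type :=
  MvPolynomial (Fin n) ℂ ⧸ toricIdeal A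

/-- The induced filtration `L_k S_A`, the image of `L_k R`. -/
def toricFilt (A : Matrix (Fin d) (Fin n) ℤ) (L : Fin n → ℚ) (k : ℚ) :
    Submodule ℂ (ToricRing A) :=
  (weightFilt L k).map (Ideal.Quotient.mkₐ ℂ (toricIdeal A)).toLinearMap

theorem monomial_mem_weightFilt (L : Fin n → ℚ) {k : ℚ} {u : Fin n →₀ ℕ}
    (h : Finsupp.weight L u ≤ k) :
    (MvPolynomial.monomial u 1 : MvPolynomial (Fin n) ℂ) ∈ weightFilt L k :=
  Submodule.subset_span ⟨u, h, rfl⟩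

theorem X_mem_weightFilt (L : Fin n → ℚ) (j : Fin n) :
    (MvPolynomial.X j : MvPolynomial (Fin n) ℂ) ∈ weightFilt L (L j) :=
  monomial_mem_weightFilt L (by simp [Finsupp.weight_single])

theorem mul_mem_weightFilt (L : Fin n → ℚ) {i j : ℚ} {a b : MvPolynomial (Fin n) ℂ}
    (ha : a ∈ weightFilt L i) (hb : b ∈ weightFilt L j) : a * b ∈ weightFilt L (i + j) := by
  have h : weightFilt L i * weightFilt L j ≤ weightFilt L (i + j) := by
    rw [weightFilt, weightFilt, Submodule.span_mul_span, Submodule.span_le]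
    rintro _ ⟨_, ⟨u, hu, rfl⟩, _, ⟨v, hv, rfl⟩, rfl⟩
    simp only [MvPolynomial.monomial_mul, mul_one]
    exact monomial_mem_weightFilt L (by rw [map_add]; exact add_le_add hu hv)
  exact h (Submodule.mul_mem_mul ha hb)

instance (A : Matrix (Fin d) (Fin n) ℤ) (L : Fin n → ℚ) :
    SetLike.GradedMonoid (toricFilt A L) where
  one_mem := ⟨1, monomial_mem_weightFilt L (u := 0) (by simp),
    map_one (Ideal.Quotient.mk (toricIdeal A))⟩
  mul_mem := by
    rintro i j _ _ ⟨a, ha, rfl⟩ ⟨b, hb, rfl⟩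
    exact ⟨a * b, mul_mem_weightFilt L ha hb, map_mul (Ideal.Quotient.mk (toricIdeal A)) a b⟩

/-- The `L`-graded toric ring `S_A^L = gr^L(S_A)`. -/
abbrev GradedToricRing (A : Matrix (Fin d) (Fin n) ℤ) (L : Fin n → ℚ) : Type :=
  Gr (toricFilt A L)

/-- The canonical homomorphism `R = gr^L(R) → gr^L(S_A) = S_A^L`; it maps `∂_j` to the class of
`∂_j mod I_A` in `L`-degree `L_j`. -/
def toGradedToricRing (A : Matrix (Fin d) (Fin n) ℤ) (L : Fin n → ℚ) :
    MvPolynomial (Fin n) ℂ →ₐ[ℂ] GradedToricRing A L :=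
  MvPolynomial.aeval fun j =>
    Gr.cls (toricFilt A L) (L j) (Ideal.Quotient.mk (toricIdeal A) (MvPolynomial.X j))
      ⟨MvPolynomial.X j, X_mem_weightFilt L j, rfl⟩

/-- The (closed) points of `Spec(S_A^L)`, that is, its `ℂ`-valued points, as points of
`ℂ^n = Spec(R)` by means of `R → S_A^L`. -/
def specPoints (A : Matrix (Fin d) (Fin n) ℤ) (L : Fin n → ℚ) : Set (Fin n → ℂ) :=
  Set.range fun (φ : GradedToricRing A L →ₐ[ℂ] ℂ) (j : Fin n) =>
    φ (toGradedToricRing A L (MvPolynomial.X j))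

/-! ### Torus orbits -/

/-- The action of the torus `𝕋 = (ℂ^*)^d` on `ℂ^n`: `t ⬝ ξ = (t^{a_1} ξ_1, …, t^{a_n} ξ_n)`. -/
def torusAct (A : Matrix (Fin d) (Fin n) ℤ) (t : Fin d → ℂˣ) (ξ : Fin n → ℂ) : Fin n → ℂ :=
  fun j => ((∏ i, t i ^ A i j : ℂˣ) : ℂ) * ξ j

/-- The orbit `O_A^τ` of the indicator vector of `τ`. -/
def orbit (A : Matrix (Fin d) (Fin n) ℤ) (τ : Finset (Fin n)) : Set (Fin n → ℂ) :=
  Set.range fun t : Fin d → ℂˣ => torusAct A t fun j => if j ∈ τ then 1 else 0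

/-- Zariski closure in `ℂ^n`. -/
def zariskiClosure (C : Set (Fin n → ℂ)) : Set (Fin n → ℂ) :=
  MvPolynomial.zeroLocus ℂ (MvPolynomial.vanishingIdeal ℂ C)

/-! ### The `(A,L)`-polyhedron and the `(A,L)`-umbrella -/

/-- Homogeneous coordinates `(q, s)` for `ℙ^d_ℚ`. -/
abbrev HomCoord (d : ℕ) : Type := (Fin d → ℚ) × ℚ

/-- Projective space `ℙ^d_ℚ = ℙ(ℚ^d × ℚ)`, containing `ℚ^d` by `q ↦ (q : 1)`. -/
abbrev ProjSpace (d : ℕ) : Type := ℙ ℚ (HomCoord d)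

/-- The complement `U_H` of the hyperplane `H = {l = 0}` of projective space. -/
def hyperplaneCompl (l : HomCoord d →ₗ[ℚ] ℚ) : Set (ProjSpace d) := {p | l p.rep ≠ 0}

/-- The identification of `U_H`, `H = {l = 0}`, with the affine space `{v | l v = 1}`. -/
def chart (l : HomCoord d →ₗ[ℚ] ℚ) (p : ProjSpace d) : HomCoord d := (l p.rep)⁻¹ • p.rep

/-- The convex hull `conv_H(B)` of `B ⊆ U_H` in the affine space `U_H`. -/
def convHullRel (l : HomCoord d →ₗ[ℚ] ℚ) (B : Set (ProjSpace d)) : Set (ProjSpace d) :=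
  {p | p ∈ hyperplaneCompl l ∧ chart l p ∈ convexHull ℚ (chart l '' B)}

/-- `F` is a face of `Δ ⊆ U_H` (the empty face included). -/
def IsFaceRel (l : HomCoord d →ₗ[ℚ] ℚ) (Δ F : Set (ProjSpace d)) : Prop :=
  F ⊆ Δ ∧ IsExposed ℚ (chart l '' Δ) (chart l '' F)

/-- The `j`-th column of `A` as a vector in `ℚ^d`. -/
def ratCol (A : Matrix (Fin d) (Fin n) ℤ) (j : Fin n) : Fin d → ℚ := fun i => (A i j : ℚ)

/-- The origin of `ℚ^d ⊆ ℙ^d_ℚ`. -/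
def origin (d : ℕ) : ProjSpace d :=
  Projectivization.mk ℚ ((0, 1) : HomCoord d) (by simp)

theorem ratCol_ne_zero (A : Matrix (Fin d) (Fin n) ℤ) (hA : ∀ j, A.col j ≠ 0) (j : Fin n) :
    ratCol A j ≠ 0 := by
  intro h
  refine hA j (funext fun i => ?_)
  have := congrFun h i
  simpa [ratCol] using this

/-- The point `a_j^L = a_j / L_j` of `ℙ^d_ℚ`. In homogeneous coordinates it is
`(a_j / L_j : 1) = (a_j : L_j)` if `L_j ≠ 0`, and the point at infinity `a_j / 0 = (a_j : 0)` on
the line through `0` and `a_j` if `L_j = 0`. -/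
def colPoint (A : Matrix (Fin d) (Fin n) ℤ) (hA : ∀ j, A.col j ≠ 0) (L : Fin n → ℚ)
    (j : Fin n) : ProjSpace d :=
  Projectivization.mk ℚ ((ratCol A j, L j) : HomCoord d)
    fun h => ratCol_ne_zero A hA j (congrArg Prod.fst h)

/-- The linear form `(q, s) ↦ h(q) + ε s`. Its zero set in `ℙ^d_ℚ` is the closure `H_ε` of the
affine hyperplane `h⁻¹(-ε)`. -/
def hypForm (h : (Fin d → ℚ) →ₗ[ℚ] ℚ) (ε : ℚ) : HomCoord d →ₗ[ℚ] ℚ :=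
  h.comp (LinearMap.fst ℚ (Fin d → ℚ) ℚ) + ε • LinearMap.snd ℚ (Fin d → ℚ) ℚ

/-- The `(A,L)`-polyhedron `Δ_A^L = conv_{H_ε}({0, a_1^L, …, a_n^L})`. -/
def polyhedron (A : Matrix (Fin d) (Fin n) ℤ) (hA : ∀ j, A.col j ≠ 0) (L : Fin n → ℚ)
    (h : (Fin d → ℚ) →ₗ[ℚ] ℚ) (ε : ℚ) : Set (ProjSpace d) :=
  convHullRel (hypForm h ε) (insert (origin d) (Set.range (colPoint A hA L)))

/-- The `(A,L)`-umbrella `Φ_A^L`: the faces of `Δ_A^L` that do not contain `0`. -/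
def umbrella (A : Matrix (Fin d) (Fin n) ℤ) (hA : ∀ j, A.col j ≠ 0) (L : Fin n → ℚ)
    (h : (Fin d → ℚ) →ₗ[ℚ] ℚ) (ε : ℚ) : Set (Set (ProjSpace d)) :=
  {F | IsFaceRel (hypForm h ε) (polyhedron A hA L h ε) F ∧ origin d ∉ F}

open Classical in
/-- The index set `{j | a_j^L ∈ F}` with which a face `F` is identified. -/
def faceCols (A : Matrix (Fin d) (Fin n) ℤ) (hA : ∀ j, A.col j ≠ 0) (L : Fin n → ℚ)
    (F : Set (ProjSpace d)) : Finset (Fin n) :=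
  Finset.univ.filter fun j => colPoint A hA L j ∈ F

/-- `dim(τ) = dim_ℚ(ℚτ) - 1`; the empty set of columns has dimension `-1`. -/
def dimCols (A : Matrix (Fin d) (Fin n) ℤ) (τ : Finset (Fin n)) : ℤ :=
  (Module.finrank ℚ (Submodule.span ℚ (ratCol A '' (τ : Set (Fin n)))) : ℤ) - 1

/-- `Φ_A^{L,k}`: the faces of dimension `k` in the umbrella. -/
def umbrellaDim (A : Matrix (Fin d) (Fin n) ℤ) (hA : ∀ j, A.col j ≠ 0) (L : Fin n → ℚ)
    (h : (Fin d → ℚ) →ₗ[ℚ] ℚ) (ε : ℚ) (k : ℤ) : Set (Set (ProjSpace d)) :=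
  {F | F ∈ umbrella A hA L h ε ∧ dimCols A (faceCols A hA L F) = k}

end GKZ

end

/-!
The whole argument compares weights of monomials. A face `τ` of the umbrella amounts to a linear
form `w` on `ℚ^d` with `w(a_j) ≤ L_j` for all `j` and equality exactly for `j ∈ τ` (`Supports`):
in homogeneous coordinates `s - w(q)` is positive at the origin, nonnegative on the polyhedron, and
cuts out the face (`exists_eq_faceSet`, `exists_mem_umbrella_of_supports`). The choice of `h` and
`ε` only matters in that all the generators are positive under the form of `H_ε`.

The ideal `I_A^τ` is the kernel of the monomial map `faceMap A τ : R → ℂ[ℤ^d]`, `∂_j ↦ t^{a_j}` for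
`j ∈ τ` and `∂_j ↦ 0` otherwise (`faceIdeal_eq_ker`), hence a graded prime. If `w` supports `τ`, a
monomial `∂^u` of degree `b` satisfies `w(b) ≤ L ⬝ u`, with equality iff its support lies in `τ`.
Hence, of an element of `I_A`, the terms of top `L`-degree that survive under `faceMap A τ` and have
a given degree are either none, or all the terms of that degree, whose coefficients sum to zero;
this gives `I_A^L ⊆ I_A^τ` (`Supports.gradedIdeal_le_ker`). The same comparison gives
`I_A^τ ⊆ I_A^τ'` for `τ' ⊆ τ`.

Conversely, let `P` be a prime containing `I_A^L`, and `τ` the set of the `j` with `∂_j ∉ P`. If no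
`w` supported `τ`, Gordan's theorem would give a binomial in `I_A` whose initial form is a
monomial supported in `τ`, or is congruent to one modulo the variables in `P`
(`exists_supports_of_isPrime`). Hence `τ` is a face and `I_A^τ ⊆ P`. If `P` is graded, equality
holds, since the graded pieces of `R / I_A^τ` are at most one-dimensional and spanned by monomials
that are not in `P`. Applied to the vanishing ideal of a point `ξ` of `Var(I_A^L)`, the same
statement shows that `ξ` is a zero of `I_A^τ` with support `τ`, and such zeros form the orbit
`O_A^τ` because `ℂˣ` is divisible, so that characters of the subgroup generated by the `a_j` with
`j ∈ τ` extend to `ℤ^d` (`mem_orbit_of_mem_zeroLocus`). The closure of `O_A^τ` is the zero locus of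
`I_A^τ`, by the linear independence of characters (`zariskiClosure_orbit`), and moving `w` until it
meets further columns places every face in a facet (`Supports.exists_facet`).
-/

noncomputable section

namespace GKZ

open scoped LinearAlgebra.Projectivization

variable {d n : ℕ}

/-! ### Face ideals as kernels of monomial maps -/

open Classical in
/-- The monomial map `R → ℂ[ℤ^d]` of `τ`: it sends `∂_j` to `t^{a_j}` if `j ∈ τ`, and to `0`
otherwise. -/
def faceMap (A : Matrix (Fin d) (Fin n) ℤ) (τ : Finset (Fin n)) :
    MvPolynomial (Fin n) ℂ →ₐ[ℂ] AddMonoidAlgebra ℂ (Fin d → ℤ) :=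
  MvPolynomial.aeval fun j => if j ∈ τ then AddMonoidAlgebra.single (A.col j) 1 else 0

open Classical in
theorem faceMap_monomial (A : Matrix (Fin d) (Fin n) ℤ) (τ : Finset (Fin n)) (u : Fin n →₀ ℕ)
    (c : ℂ) : faceMap A τ (MvPolynomial.monomial u c) =
      if u.support ⊆ τ then AddMonoidAlgebra.single (Finsupp.weight A.col u) c else 0 := by
  rw [faceMap, MvPolynomial.aeval_monomial]
  split_ifs with h
  · have : (u.prod fun j k => (if j ∈ τ then AddMonoidAlgebra.single (A.col j) (1 : ℂ) else 0) ^ k)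
        = AddMonoidAlgebra.single (Finsupp.weight A.col u) 1 := by
      rw [Finsupp.weight_apply, Finsupp.prod, Finsupp.sum]
      rw [Finset.prod_congr rfl fun j hj => by rw [if_pos (h hj), AddMonoidAlgebra.single_pow]]
      rw [AddMonoidAlgebra.prod_single]
      simp
    rw [this, AddMonoidAlgebra.coe_algebraMap]
    simp [AddMonoidAlgebra.single_mul_single]
  · obtain ⟨j, hj, hjτ⟩ := Finset.not_subset.1 h
    rw [Finsupp.prod, Finset.prod_eq_zero hj, mul_zero]
    rw [if_neg hjτ, zero_pow (Finsupp.mem_support_iff.1 hj)]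

instance faceMap_ker_isPrime (A : Matrix (Fin d) (Fin n) ℤ) (τ : Finset (Fin n)) :
    (RingHom.ker (faceMap A τ)).IsPrime :=
  RingHom.ker_isPrime _

/-- The degree-`b` component of `f` maps to the term `t^b` of the image of `f`. -/
theorem faceMap_weightedHomogeneousComponent (A : Matrix (Fin d) (Fin n) ℤ) (τ : Finset (Fin n))
    (b : Fin d → ℤ) (f : MvPolynomial (Fin n) ℂ) :
    faceMap A τ (MvPolynomial.weightedHomogeneousComponent A.col b f) =
      AddMonoidAlgebra.single b ((faceMap A τ f).coeff b) := by
  classical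
  induction f using MvPolynomial.induction_on' with
  | monomial u c =>
    by_cases hb : Finsupp.weight A.col u = b
    · rw [MvPolynomial.weightedHomogeneousComponent_of_mem
        (MvPolynomial.isWeightedHomogeneous_monomial _ u c hb), if_pos rfl, faceMap_monomial]
      split_ifs <;> simp [hb]
    · rw [MvPolynomial.weightedHomogeneousComponent_of_mem
        (MvPolynomial.isWeightedHomogeneous_monomial _ u c rfl), if_neg (Ne.symm hb),
        faceMap_monomial]
      split_ifs <;> simp [hb]
  | add f g hf hg => simp [hf, hg]

theorem isGradedIdeal_iff (A : Matrix (Fin d) (Fin n) ℤ) (P : Ideal (MvPolynomial (Fin n) ℂ)) :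
    IsGradedIdeal A P ↔
      ∀ b, ∀ f ∈ P, MvPolynomial.weightedHomogeneousComponent A.col b f ∈ P := by
  let := MvPolynomial.weightedGradedAlgebra ℂ A.col
  have key : ∀ b f, (DirectSum.decompose (MvPolynomial.weightedHomogeneousSubmodule ℂ A.col) f b :
      MvPolynomial (Fin n) ℂ) = MvPolynomial.weightedHomogeneousComponent A.col b f := fun b f =>
    MvPolynomial.weightedDecomposition.decompose'_apply ℂ A.col f b
  unfold IsGradedIdeal
  exact ⟨fun h b f hf => key b f ▸ h b hf, fun h b f hf => (key b f).symm ▸ h b f hf⟩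

theorem isGradedIdeal_ker_faceMap (A : Matrix (Fin d) (Fin n) ℤ) (τ : Finset (Fin n)) :
    IsGradedIdeal A (RingHom.ker (faceMap A τ)) := by
  rw [isGradedIdeal_iff]
  intro b f hf
  rw [RingHom.mem_ker] at hf ⊢
  rw [faceMap_weightedHomogeneousComponent, hf]
  simp

theorem box_eq_monomial_sub {ι : Type*} [Fintype ι] (z : ι → ℤ) :
    box z = MvPolynomial.monomial (Finsupp.equivFunOnFinite.symm fun j => (z j).toNat) 1 -
      MvPolynomial.monomial (Finsupp.equivFunOnFinite.symm fun j => (-z j).toNat) 1 := by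
  simp [box, MvPolynomial.monomial_eq, Finsupp.prod_fintype]

theorem weight_col_apply {ι : Type*} [Fintype ι] (B : Matrix (Fin d) ι ℤ) (u : ι →₀ ℕ) :
    Finsupp.weight B.col u = B.mulVec fun j => (u j : ℤ) := by
  ext i
  rw [Finsupp.weight_apply, Finsupp.sum_fintype _ _ (by simp)]
  simp [Matrix.mulVec, dotProduct, mul_comm]

/-- Two monomials of the same degree are congruent modulo the toric ideal. -/
theorem monomial_sub_mem_toricIdeal {ι : Type*} [Fintype ι] (B : Matrix (Fin d) ι ℤ)
    {u v : ι →₀ ℕ} (h : Finsupp.weight B.col u = Finsupp.weight B.col v) :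
    (MvPolynomial.monomial u 1 - MvPolynomial.monomial v 1 : MvPolynomial ι ℂ) ∈
      toricIdeal B := by
  set z : ι → ℤ := fun j => (u j : ℤ) - v j with hz
  -- the common factor `∂^{min(u, v)}` times a binomial generator
  have key : (MvPolynomial.monomial u 1 - MvPolynomial.monomial v 1 : MvPolynomial ι ℂ) =
      MvPolynomial.monomial (Finsupp.equivFunOnFinite.symm fun j => min (u j) (v j)) 1 *
        box z := by
    rw [box_eq_monomial_sub, mul_sub, MvPolynomial.monomial_mul, MvPolynomial.monomial_mul,
      one_mul]
    congr 3 <;> ext j <;> simp [hz] <;> omega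
  rw [key]
  refine Ideal.mul_mem_left _ _ (Ideal.subset_span ⟨z, ?_, rfl⟩)
  rw [weight_col_apply, weight_col_apply] at h
  have : z = (fun j => (u j : ℤ)) - fun j => (v j : ℤ) := rfl
  rw [this, Matrix.mulVec_sub, h, sub_self]

theorem exists_mapDomain_of_support_subset {τ : Finset (Fin n)} {u : Fin n →₀ ℕ}
    (h : u.support ⊆ τ) : ∃ v : τ →₀ ℕ, v.mapDomain Subtype.val = u := by
  refine ⟨u.comapDomain Subtype.val Subtype.val_injective.injOn, ?_⟩
  refine Finsupp.mapDomain_comapDomain _ Subtype.val_injective _ fun j hj => ?_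
  exact ⟨⟨j, h hj⟩, rfl⟩

theorem weight_mapDomain_val (A : Matrix (Fin d) (Fin n) ℤ) {τ : Finset (Fin n)} (v : τ →₀ ℕ) :
    Finsupp.weight A.col (v.mapDomain Subtype.val) =
      Finsupp.weight (colsSubmatrix A τ).col v := by
  rw [Finsupp.weight_apply, Finsupp.weight_apply, Finsupp.sum_mapDomain_index (by simp)
    (by intros; simp [add_smul])]
  rfl

/-- Two monomials of the same degree with support in `τ` are congruent modulo `I_A^τ`. -/
theorem monomial_sub_mem_faceIdeal (A : Matrix (Fin d) (Fin n) ℤ) {τ : Finset (Fin n)}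
    {u v : Fin n →₀ ℕ} (hu : u.support ⊆ τ) (hv : v.support ⊆ τ)
    (h : Finsupp.weight A.col u = Finsupp.weight A.col v) :
    (MvPolynomial.monomial u 1 - MvPolynomial.monomial v 1 : MvPolynomial (Fin n) ℂ) ∈
      faceIdeal A τ := by
  obtain ⟨u, rfl⟩ := exists_mapDomain_of_support_subset hu
  obtain ⟨v, rfl⟩ := exists_mapDomain_of_support_subset hv
  rw [weight_mapDomain_val, weight_mapDomain_val] at h
  have := Ideal.mem_map_of_mem
    (MvPolynomial.rename (R := ℂ) (Subtype.val : τ → Fin n)).toRingHom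
    (monomial_sub_mem_toricIdeal _ h)
  refine Ideal.mem_sup_left ?_
  simpa [MvPolynomial.rename_monomial] using this

theorem monomial_mem_faceIdeal (A : Matrix (Fin d) (Fin n) ℤ) {τ : Finset (Fin n)}
    {u : Fin n →₀ ℕ} (hu : ¬ u.support ⊆ τ) :
    (MvPolynomial.monomial u 1 : MvPolynomial (Fin n) ℂ) ∈ faceIdeal A τ := by
  obtain ⟨j, hj, hjτ⟩ := Finset.not_subset.1 hu
  refine Ideal.mem_sup_right ?_
  refine Ideal.mem_of_dvd _ ?_ (Ideal.subset_span ⟨j, hjτ, rfl⟩)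
  rw [MvPolynomial.X_dvd_monomial]
  exact Or.inr (Finsupp.mem_support_iff.1 hj)

/-- An ideal contains `I_A^τ` if it contains the variables outside `τ` and the binomials supported
in `τ`. -/
theorem faceIdeal_le_of (A : Matrix (Fin d) (Fin n) ℤ) {τ : Finset (Fin n)}
    {P : Ideal (MvPolynomial (Fin n) ℂ)} (hX : ∀ j, j ∉ τ → MvPolynomial.X j ∈ P)
    (hb : ∀ u v : Fin n →₀ ℕ, u.support ⊆ τ → v.support ⊆ τ →
      Finsupp.weight A.col u = Finsupp.weight A.col v →
      (MvPolynomial.monomial u 1 - MvPolynomial.monomial v 1 : MvPolynomial (Fin n) ℂ) ∈ P) :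
    faceIdeal A τ ≤ P := by
  classical
  refine sup_le (Ideal.map_le_iff_le_comap.2 (Ideal.span_le.2 ?_)) (Ideal.span_le.2 ?_)
  · rintro _ ⟨z, hz, rfl⟩
    have hsupp : ∀ v : τ →₀ ℕ, (v.mapDomain Subtype.val).support ⊆ τ := fun v j hj => by
      have := Finsupp.mapDomain_support hj
      simp only [Finset.mem_image] at this
      obtain ⟨i, -, rfl⟩ := this
      exact i.2
    have := hb _ _ (hsupp (Finsupp.equivFunOnFinite.symm fun j => (z j).toNat))
      (hsupp (Finsupp.equivFunOnFinite.symm fun j => (-z j).toNat)) ?_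
    · simpa [box_eq_monomial_sub, MvPolynomial.rename_monomial] using this
    · rw [weight_mapDomain_val, weight_mapDomain_val, weight_col_apply, weight_col_apply,
        ← sub_eq_zero, ← Matrix.mulVec_sub, ← hz]
      congr 1
      ext j
      simp
  · rintro _ ⟨j, hj, rfl⟩
    exact hX j hj

open Classical in
/-- A monomial with support in `τ` and degree `b`, or `0` if there is none. -/
def faceMonomial (A : Matrix (Fin d) (Fin n) ℤ) (τ : Finset (Fin n)) (b : Fin d → ℤ) :
    MvPolynomial (Fin n) ℂ :=
  if h : ∃ u : Fin n →₀ ℕ, u.support ⊆ τ ∧ Finsupp.weight A.col u = b then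
    MvPolynomial.monomial h.choose 1 else 0

/-- Modulo `I_A^τ`, a polynomial is determined by its image in `ℂ[ℤ^d]`. -/
theorem sub_sum_faceMonomial_mem_faceIdeal (A : Matrix (Fin d) (Fin n) ℤ) (τ : Finset (Fin n))
    (f : MvPolynomial (Fin n) ℂ) :
    f - (faceMap A τ f).coeff.sum (fun b c => c • faceMonomial A τ b) ∈ faceIdeal A τ := by
  classical
  induction f using MvPolynomial.induction_on' with
  | monomial u c =>
    have hc : MvPolynomial.monomial u c = c • (MvPolynomial.monomial u 1 :
        MvPolynomial (Fin n) ℂ) := by simp [MvPolynomial.smul_monomial]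
    rw [faceMap_monomial]
    split_ifs with h
    · rw [AddMonoidAlgebra.coeff_single, Finsupp.sum_single_index (by simp), hc, ← smul_sub]
      refine Submodule.smul_of_tower_mem _ _ ?_
      have hex : ∃ v : Fin n →₀ ℕ, v.support ⊆ τ ∧
        Finsupp.weight A.col v = Finsupp.weight A.col u := ⟨u, h, rfl⟩
      rw [faceMonomial, dif_pos hex]
      exact monomial_sub_mem_faceIdeal A h hex.choose_spec.1 hex.choose_spec.2.symm
    · rw [AddMonoidAlgebra.coeff_zero, Finsupp.sum_zero_index, sub_zero, hc]
      exact Submodule.smul_of_tower_mem _ _ (monomial_mem_faceIdeal A h)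
  | add f g hf hg =>
    rw [map_add, AddMonoidAlgebra.coeff_add, Finsupp.sum_add_index' (by simp)
      (by intros; rw [add_smul]), add_sub_add_comm]
    exact add_mem hf hg

theorem faceIdeal_eq_ker (A : Matrix (Fin d) (Fin n) ℤ) (τ : Finset (Fin n)) :
    faceIdeal A τ = RingHom.ker (faceMap A τ) := by
  refine le_antisymm (faceIdeal_le_of A (fun j hj => ?_) fun u v hu hv h => ?_) fun f hf => ?_
  · simp [RingHom.mem_ker, faceMap, hj]
  · rw [RingHom.mem_ker, map_sub, faceMap_monomial, faceMap_monomial, if_pos hu, if_pos hv, h,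
      sub_self]
  · have := sub_sum_faceMonomial_mem_faceIdeal A τ f
    rwa [(RingHom.mem_ker).1 hf, AddMonoidAlgebra.coeff_zero, Finsupp.sum_zero_index,
      sub_zero] at this

theorem toricIdeal_le_ker_faceMap_univ (A : Matrix (Fin d) (Fin n) ℤ) :
    toricIdeal A ≤ RingHom.ker (faceMap A Finset.univ) := by
  refine Ideal.span_le.2 ?_
  rintro _ ⟨z, hz, rfl⟩
  rw [SetLike.mem_coe, RingHom.mem_ker, box_eq_monomial_sub, map_sub, faceMap_monomial,
    faceMap_monomial, if_pos (Finset.subset_univ _), if_pos (Finset.subset_univ _), sub_eq_zero]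
  congr 1
  rw [weight_col_apply, weight_col_apply, ← sub_eq_zero, ← Matrix.mulVec_sub, ← hz]
  congr 1
  ext j
  simp

/-- A graded ideal containing `I_A^τ`, but no monomial with support in `τ`, is `I_A^τ`: the graded
pieces of `R / I_A^τ` are spanned by such monomials. -/
theorem eq_faceIdeal_of_isGradedIdeal (A : Matrix (Fin d) (Fin n) ℤ) {τ : Finset (Fin n)}
    {P : Ideal (MvPolynomial (Fin n) ℂ)} (hP : IsGradedIdeal A P) (hle : faceIdeal A τ ≤ P)
    (hm : ∀ u : Fin n →₀ ℕ, u.support ⊆ τ →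
      (MvPolynomial.monomial u 1 : MvPolynomial (Fin n) ℂ) ∉ P) :
    P = faceIdeal A τ := by
  classical
  rw [isGradedIdeal_iff] at hP
  refine le_antisymm (fun f hf => ?_) hle
  rw [faceIdeal_eq_ker, RingHom.mem_ker]
  ext b
  by_contra hb
  have h1 := sub_sum_faceMonomial_mem_faceIdeal A τ
    (MvPolynomial.weightedHomogeneousComponent A.col b f)
  rw [faceMap_weightedHomogeneousComponent, AddMonoidAlgebra.coeff_single,
    Finsupp.sum_single_index (by simp)] at h1
  have h2 : (faceMap A τ f).coeff b • faceMonomial A τ b ∈ P := by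
    simpa using sub_mem (hP b f hf) (hle h1)
  have h3 : faceMonomial A τ b ∈ P := by
    simpa [smul_smul, inv_mul_cancel₀ hb] using
      Submodule.smul_of_tower_mem P ((faceMap A τ f).coeff b)⁻¹ h2
  rw [faceMonomial] at h3
  split_ifs at h3 with hex
  · exact hm _ hex.choose_spec.1 h3
  · -- no monomial of degree `b` is supported in `τ`, so `t^b` does not occur in the image of `f`
    refine hb ?_
    clear hf h1 h2 h3 hb
    induction f using MvPolynomial.induction_on' with
    | monomial u c =>
      rw [faceMap_monomial]
      split_ifs with hu
      · have : Finsupp.weight A.col u ≠ b := fun h => hex ⟨u, hu, h⟩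
        simp [this]
      · simp
    | add f g hf hg => simp [map_add, hf, hg]

/-! ### Linear forms supporting a face -/

/-- The linear form `(q, s) ↦ s - w(q)`. -/
def affineForm (w : (Fin d → ℚ) →ₗ[ℚ] ℚ) : HomCoord d →ₗ[ℚ] ℚ :=
  LinearMap.snd ℚ (Fin d → ℚ) ℚ - w.comp (LinearMap.fst ℚ (Fin d → ℚ) ℚ)

@[simp]
theorem affineForm_apply (w : (Fin d → ℚ) →ₗ[ℚ] ℚ) (v : HomCoord d) :
    affineForm w v = v.2 - w v.1 := rfl

/-- A linear form that is nonzero at `(0, 1)` is a multiple of some `s - w(q)`. -/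
theorem exists_eq_mul_affineForm (ψ : HomCoord d →ₗ[ℚ] ℚ) (ho : ψ (0, 1) ≠ 0) :
    ∃ w, ∀ v, ψ v = ψ (0, 1) * affineForm w v := by
  refine ⟨-((ψ (0, 1))⁻¹ • ψ.comp (LinearMap.inl ℚ (Fin d → ℚ) ℚ)), fun v => ?_⟩
  have : v = (v.1, 0) + v.2 • (0, 1) := by ext <;> simp
  conv_lhs => rw [this, map_add, map_smul]
  simp only [affineForm_apply, LinearMap.neg_apply, LinearMap.smul_apply, LinearMap.comp_apply,
    LinearMap.inl_apply, smul_eq_mul]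
  field_simp
  ring

/-- The linear form `w` satisfies `w(a_j) ≤ L_j` for all `j`, with equality exactly for `j ∈ τ`.
In homogeneous coordinates, `(q, s) ↦ s - w(q)` is positive at the origin, nonnegative at all
`a_j^L`, and zero exactly at the `a_j^L` with `j ∈ τ`. -/
structure Supports (A : Matrix (Fin d) (Fin n) ℤ) (L : Fin n → ℚ) (w : (Fin d → ℚ) →ₗ[ℚ] ℚ)
    (τ : Finset (Fin n)) : Prop where
  eq : ∀ j ∈ τ, w (ratCol A j) = L j
  lt : ∀ j, j ∉ τ → w (ratCol A j) < L j

/-- The inclusion `ℤ^d → ℚ^d`. -/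
def ratVec (d : ℕ) : (Fin d → ℤ) →+ (Fin d → ℚ) := (Int.castAddHom ℚ).compLeft (Fin d)

theorem ratVec_col (A : Matrix (Fin d) (Fin n) ℤ) (j : Fin n) :
    ratVec d (A.col j) = ratCol A j := rfl

theorem apply_ratVec_weight (A : Matrix (Fin d) (Fin n) ℤ) (w : (Fin d → ℚ) →ₗ[ℚ] ℚ)
    (u : Fin n →₀ ℕ) : w (ratVec d (Finsupp.weight A.col u)) =
      ∑ j, (u j : ℚ) * w (ratCol A j) := by
  rw [Finsupp.weight_apply, Finsupp.sum_fintype _ _ (by simp), map_sum, map_sum]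
  refine Finset.sum_congr rfl fun j _ => ?_
  rw [map_nsmul, map_nsmul, ratVec_col, nsmul_eq_mul]

theorem weight_eq_sum (L : Fin n → ℚ) (u : Fin n →₀ ℕ) :
    Finsupp.weight L u = ∑ j, (u j : ℚ) * L j := by
  rw [Finsupp.weight_apply, Finsupp.sum_fintype _ _ (by simp)]
  simp

theorem sum_mul_eq_iff_support_subset {x y : Fin n → ℚ} {τ : Finset (Fin n)} {u : Fin n →₀ ℕ}
    (heq : ∀ j ∈ τ, x j = y j) (hlt : ∀ j, j ∉ τ → x j < y j) :
    (∑ j, (u j : ℚ) * x j = ∑ j, (u j : ℚ) * y j) ↔ u.support ⊆ τ := by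
  have hle : ∀ j ∈ Finset.univ, (u j : ℚ) * x j ≤ u j * y j := fun j _ => by
    by_cases hj : j ∈ τ
    · rw [heq j hj]
    · exact mul_le_mul_of_nonneg_left (hlt j hj).le (Nat.cast_nonneg _)
  rw [Finset.sum_eq_sum_iff_of_le hle]
  constructor
  · intro h j hj
    by_contra hjτ
    have hpos : (0 : ℚ) < u j :=
      Nat.cast_pos.2 (Nat.pos_of_ne_zero (Finsupp.mem_support_iff.1 hj))
    exact (mul_lt_mul_of_pos_left (hlt j hjτ) hpos).ne (h j (Finset.mem_univ j))
  · intro h j _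
    by_cases hj : j ∈ τ
    · rw [heq j hj]
    · rw [Finsupp.notMem_support_iff.1 fun hu => hj (h hu)]
      simp

theorem Supports.le {A : Matrix (Fin d) (Fin n) ℤ} {L : Fin n → ℚ} {w : (Fin d → ℚ) →ₗ[ℚ] ℚ}
    {τ : Finset (Fin n)} (h : Supports A L w τ) (j : Fin n) : w (ratCol A j) ≤ L j := by
  by_cases hj : j ∈ τ
  · exact (h.eq j hj).le
  · exact (h.lt j hj).le

theorem Supports.mem_iff {A : Matrix (Fin d) (Fin n) ℤ} {L : Fin n → ℚ}
    {w : (Fin d → ℚ) →ₗ[ℚ] ℚ} {τ : Finset (Fin n)} (h : Supports A L w τ) (j : Fin n) :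
    j ∈ τ ↔ w (ratCol A j) = L j :=
  ⟨h.eq j, fun hj => by_contra fun hjτ => (h.lt j hjτ).ne hj⟩

/-! ### Initial forms and degenerations -/

/-- The image under the monomial map of `τ` of the top-degree form of `f ∈ L_k R` consists of
those terms `t^b` of the image of `f` in `ℂ[ℤ^d]` with `w(b) = k`: a monomial `∂^u` of degree `b`
has `w(b) ≤ L ⬝ u`, with equality exactly if its support lies in `τ`. -/
theorem Supports.coeff_faceMap_initial {A : Matrix (Fin d) (Fin n) ℤ} {L : Fin n → ℚ}
    {w : (Fin d → ℚ) →ₗ[ℚ] ℚ} {τ : Finset (Fin n)} (h : Supports A L w τ) {k : ℚ}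
    {f : MvPolynomial (Fin n) ℂ} (hf : f ∈ weightFilt L k) (b : Fin d → ℤ) :
    (faceMap A τ (MvPolynomial.weightedHomogeneousComponent L k f)).coeff b =
      if w (ratVec d b) = k then (faceMap A Finset.univ f).coeff b else 0 := by
  classical
  induction hf using Submodule.span_induction with
  | mem f hf =>
    obtain ⟨u, hu, rfl⟩ := hf
    have hiff := sum_mul_eq_iff_support_subset (u := u) h.eq h.lt
    rw [← apply_ratVec_weight, ← weight_eq_sum] at hiff
    have hle : w (ratVec d (Finsupp.weight A.col u)) ≤ Finsupp.weight L u := by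
      rw [apply_ratVec_weight, weight_eq_sum]
      exact Finset.sum_le_sum fun j _ => mul_le_mul_of_nonneg_left (h.le j) (Nat.cast_nonneg _)
    rw [MvPolynomial.weightedHomogeneousComponent_of_mem
        (MvPolynomial.isWeightedHomogeneous_monomial _ u 1 rfl), faceMap_monomial,
      if_pos (Finset.subset_univ _), AddMonoidAlgebra.coeff_single, Finsupp.single_apply]
    by_cases hb : Finsupp.weight A.col u = b
    · subst hb
      rw [if_pos rfl]
      by_cases hk : k = Finsupp.weight L u
      · subst hk
        simp only [hiff, faceMap_monomial, if_true]
        split_ifs <;> simp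
      · rw [if_neg hk, if_neg]
        · simp
        · rintro rfl
          exact hk (le_antisymm hle hu)
    · rw [if_neg hb, ite_self]
      split_ifs
      · rw [faceMap_monomial]
        split_ifs <;> simp [hb]
      · simp
  | zero => simp
  | add f g _ _ hf hg =>
    simp only [map_add, AddMonoidAlgebra.coeff_add, Finsupp.add_apply, hf, hg]
    split_ifs <;> simp
  | smul c f _ hf =>
    simp only [map_smul, AddMonoidAlgebra.coeff_smul, Finsupp.smul_apply, hf]
    split_ifs <;> simp

theorem Supports.gradedIdeal_le_ker {A : Matrix (Fin d) (Fin n) ℤ} {L : Fin n → ℚ}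
    {w : (Fin d → ℚ) →ₗ[ℚ] ℚ} {τ : Finset (Fin n)} (h : Supports A L w τ) :
    gradedIdeal L (toricIdeal A) ≤ RingHom.ker (faceMap A τ) := by
  refine Ideal.span_le.2 ?_
  rintro _ ⟨k, f, hfI, hf, rfl⟩
  rw [SetLike.mem_coe, RingHom.mem_ker]
  ext b
  rw [h.coeff_faceMap_initial hf, RingHom.mem_ker.1 (toricIdeal_le_ker_faceMap_univ A hfI)]
  simp

/-- If `τ' ⊆ τ`, then `I_A^τ ⊆ I_A^τ'`: the difference `w - w'` of two supporting forms
vanishes on `τ'` and is positive on `τ \ τ'`, so that it selects among the monomials supported in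
`τ` those supported in `τ'` by their degree. -/
theorem Supports.ker_faceMap_anti {A : Matrix (Fin d) (Fin n) ℤ} {L : Fin n → ℚ}
    {w w' : (Fin d → ℚ) →ₗ[ℚ] ℚ} {τ τ' : Finset (Fin n)} (h : Supports A L w τ)
    (h' : Supports A L w' τ') (hsub : τ' ⊆ τ) :
    RingHom.ker (faceMap A τ) ≤ RingHom.ker (faceMap A τ') := by
  classical
  have key : ∀ (f : MvPolynomial (Fin n) ℂ) (b : Fin d → ℤ), (faceMap A τ' f).coeff b =
      if w' (ratVec d b) = w (ratVec d b) then (faceMap A τ f).coeff b else 0 := by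
    intro f b
    induction f using MvPolynomial.induction_on' with
    | monomial u c =>
      rw [faceMap_monomial, faceMap_monomial]
      by_cases hb : Finsupp.weight A.col u = b
      · subst hb
        by_cases hu : u.support ⊆ τ
        · have hiff : w' (ratVec d (Finsupp.weight A.col u)) =
              w (ratVec d (Finsupp.weight A.col u)) ↔ u.support ⊆ τ' := by
            -- off `τ` the exponents vanish, so the form `w` may be compared through `L`
            have hL : w (ratVec d (Finsupp.weight A.col u)) = ∑ j, (u j : ℚ) * L j := by
              rw [apply_ratVec_weight]
              exact (sum_mul_eq_iff_support_subset h.eq h.lt).2 hu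
            rw [hL, apply_ratVec_weight]
            exact sum_mul_eq_iff_support_subset h'.eq h'.lt
          rw [if_pos hu]
          simp only [hiff]
          split_ifs <;> simp
        · rw [if_neg hu, if_neg fun hu' => hu (hu'.trans hsub)]
          simp
      · split_ifs <;> simp [hb]
    | add f g hf hg =>
      simp only [map_add, AddMonoidAlgebra.coeff_add, Finsupp.add_apply, hf, hg]
      split_ifs <;> simp
  intro f hf
  rw [RingHom.mem_ker] at hf ⊢
  ext b
  rw [key, hf]
  simp

/-! ### Gordan's theorem -/

/-- Gordan's theorem relative to a subspace `W`: if no nontrivial nonnegative combination of the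
`x i` lies in `W`, then some linear form vanishes on `W` and is positive at every `x i`. -/
theorem exists_dual_pos_of_forall_relation_trivial {K V ι : Type*} [Field K] [LinearOrder K]
    [IsStrictOrderedRing K] [AddCommGroup V] [Module K V] (x : ι → V) (s : Finset ι)
    (W : Submodule K V)
    (hW : ∀ c : ι → K, (∀ i ∈ s, 0 ≤ c i) → ∑ i ∈ s, c i • x i ∈ W → ∀ i ∈ s, c i = 0) :
    ∃ ψ : V →ₗ[K] K, (∀ v ∈ W, ψ v = 0) ∧ ∀ i ∈ s, 0 < ψ (x i) := by
  classical
  induction s using Finset.induction_on generalizing W with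
  | empty => exact ⟨0, by simp⟩
  | insert a s ha ih =>
    -- the hypothesis for `insert a s`, in terms of the coefficient of `x a` and the others
    have hW' : ∀ (c : ι → K) (r : K), (∀ i ∈ s, 0 ≤ c i) → 0 ≤ r →
        r • x a + ∑ i ∈ s, c i • x i ∈ W → r = 0 ∧ ∀ i ∈ s, c i = 0 := by
      intro c r hc hr hmem
      have hne : ∀ i ∈ s, i ≠ a := fun i hi h => ha (h ▸ hi)
      have := hW (Function.update c a r) ?_ ?_
      · refine ⟨by simpa using this a (Finset.mem_insert_self _ _), fun i hi => ?_⟩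
        simpa [hne i hi] using this i (Finset.mem_insert_of_mem hi)
      · intro i hi
        rcases Finset.mem_insert.1 hi with rfl | hi
        · simpa using hr
        · simpa [hne i hi] using hc i hi
      · rw [Finset.sum_insert ha, Function.update_self,
          Finset.sum_congr rfl fun i hi => by rw [Function.update_of_ne (hne i hi)]]
        exact hmem
    by_cases H : ∀ c : ι → K, (∀ i ∈ s, 0 ≤ c i) →
        ∑ i ∈ s, c i • x i ∈ W ⊔ Submodule.span K {x a} → ∀ i ∈ s, c i = 0
    · -- a large multiple of a form that vanishes at `x a`, plus a form that is positive at `x a`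
      obtain ⟨ψ₁, hψ₁, hpos⟩ := ih _ H
      have hxa : x a ∉ W := fun hmem => by
        have := (hW' 0 1 (by simp) zero_le_one (by simpa using hmem)).1
        exact one_ne_zero this
      obtain ⟨φ, hφ, hφW⟩ := Submodule.exists_le_ker_of_notMem hxa
      set ψ₂ := (φ (x a))⁻¹ • φ with hψ₂
      have h2a : ψ₂ (x a) = 1 := by simp [hψ₂, hφ]
      set N : K := ∑ i ∈ s, (|ψ₂ (x i)| + 1) / ψ₁ (x i)
      refine ⟨N • ψ₁ + ψ₂, fun v hv => ?_, fun i hi => ?_⟩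
      · have : φ v = 0 := hφW hv
        simp [hψ₁ v (Submodule.mem_sup_left hv), hψ₂, this]
      · rcases Finset.mem_insert.1 hi with rfl | hi
        · have := hψ₁ (x i) (Submodule.mem_sup_right (Submodule.mem_span_singleton_self _))
          simp [this, h2a]
        · have hN : (|ψ₂ (x i)| + 1) / ψ₁ (x i) ≤ N :=
            Finset.single_le_sum (f := fun i => (|ψ₂ (x i)| + 1) / ψ₁ (x i))
              (fun k hk => div_nonneg (by positivity) (hpos k hk).le) hi
          rw [div_le_iff₀ (hpos i hi)] at hN
          have := neg_abs_le (ψ₂ (x i))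
          simp only [LinearMap.add_apply, LinearMap.smul_apply, smul_eq_mul]
          linarith
    · -- `x a` is, modulo `W`, a positive combination of the others
      push Not at H
      obtain ⟨c, hc, hmem, i₀, hi₀, hci₀⟩ := H
      obtain ⟨y, hy, z, hz, hyz⟩ := Submodule.mem_sup.1 hmem
      obtain ⟨r, rfl⟩ := Submodule.mem_span_singleton.1 hz
      have hr : 0 < r := by
        by_contra hr
        refine hci₀ ((hW' c (-r) hc (by linarith) ?_).2 i₀ hi₀)
        rw [← hyz]
        convert hy using 1
        module
      obtain ⟨ψ, hψ, hpos⟩ := ih W fun c hc hmem => (hW' c 0 hc le_rfl (by simpa using hmem)).2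
      refine ⟨ψ, hψ, fun i hi => ?_⟩
      rcases Finset.mem_insert.1 hi with rfl | hi
      · have h1 : r * ψ (x i) = ∑ k ∈ s, c k * ψ (x k) := by
          have := congrArg ψ hyz
          simpa [hψ y hy] using this
        have h2 : 0 < ∑ k ∈ s, c k * ψ (x k) :=
          Finset.sum_pos' (fun k hk => mul_nonneg (hc k hk) (hpos k hk).le)
            ⟨i₀, hi₀, mul_pos (lt_of_le_of_ne (hc i₀ hi₀) (Ne.symm hci₀)) (hpos i₀ hi₀)⟩
        rw [← h1] at h2
        exact pos_of_mul_pos_right h2 hr.le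
      · exact hpos i hi

/-! ### Primes containing the graded toric ideal -/

theorem exists_int_multiple (z : Fin n → ℚ) :
    ∃ N : ℕ, 0 < N ∧ ∃ m : Fin n → ℤ, ∀ j, (m j : ℚ) = N * z j := by
  refine ⟨∏ j, (z j).den, Finset.prod_pos fun j _ => (z j).den_pos, ?_⟩
  have : ∀ j, ∃ m : ℤ, (m : ℚ) = ((∏ j, (z j).den : ℕ) : ℚ) * z j := fun j => by
    obtain ⟨k, hk⟩ := Finset.dvd_prod_of_mem (fun j => (z j).den) (Finset.mem_univ j)
    refine ⟨(z j).num * k, ?_⟩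
    rw [hk]
    push_cast
    have := Rat.mul_den_eq_num (z j)
    rw [← this]
    ring
  choose m hm using this
  exact ⟨m, hm⟩

theorem monomial_sub_mem_gradedIdeal (A : Matrix (Fin d) (Fin n) ℤ) (L : Fin n → ℚ)
    {u v : Fin n →₀ ℕ} (h : Finsupp.weight A.col u = Finsupp.weight A.col v)
    (hL : Finsupp.weight L u = Finsupp.weight L v) :
    (MvPolynomial.monomial u 1 - MvPolynomial.monomial v 1 : MvPolynomial (Fin n) ℂ) ∈
      gradedIdeal L (toricIdeal A) := by
  refine Ideal.subset_span ⟨Finsupp.weight L v, _, monomial_sub_mem_toricIdeal A h,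
    sub_mem (monomial_mem_weightFilt L hL.le) (monomial_mem_weightFilt L le_rfl), ?_⟩
  classical
  rw [map_sub, MvPolynomial.weightedHomogeneousComponent_of_mem
      (MvPolynomial.isWeightedHomogeneous_monomial _ u 1 hL),
    MvPolynomial.weightedHomogeneousComponent_of_mem
      (MvPolynomial.isWeightedHomogeneous_monomial _ v 1 rfl), if_pos rfl, if_pos rfl]

theorem monomial_mem_gradedIdeal (A : Matrix (Fin d) (Fin n) ℤ) (L : Fin n → ℚ)
    {u v : Fin n →₀ ℕ} (h : Finsupp.weight A.col u = Finsupp.weight A.col v)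
    (hL : Finsupp.weight L u < Finsupp.weight L v) :
    (MvPolynomial.monomial v 1 : MvPolynomial (Fin n) ℂ) ∈ gradedIdeal L (toricIdeal A) := by
  refine Ideal.subset_span ⟨Finsupp.weight L v, _, monomial_sub_mem_toricIdeal A h.symm,
    sub_mem (monomial_mem_weightFilt L le_rfl) (monomial_mem_weightFilt L hL.le), ?_⟩
  classical
  rw [map_sub, MvPolynomial.weightedHomogeneousComponent_of_mem
      (MvPolynomial.isWeightedHomogeneous_monomial _ u 1 rfl),
    MvPolynomial.weightedHomogeneousComponent_of_mem
      (MvPolynomial.isWeightedHomogeneous_monomial _ v 1 rfl), if_pos rfl, if_neg hL.ne', sub_zero]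

theorem monomial_mem_iff_of_isPrime {P : Ideal (MvPolynomial (Fin n) ℂ)} (hP : P.IsPrime)
    {τ : Finset (Fin n)} (hτ : ∀ j, j ∈ τ ↔ MvPolynomial.X j ∉ P) (u : Fin n →₀ ℕ) :
    (MvPolynomial.monomial u 1 : MvPolynomial (Fin n) ℂ) ∈ P ↔ ¬ u.support ⊆ τ := by
  rw [MvPolynomial.monomial_eq, Finsupp.prod, map_one, one_mul, hP.prod_mem_iff,
    Finset.not_subset]
  refine exists_congr fun j => and_congr_right fun hj => ?_
  rw [hP.pow_mem_iff_mem _ (Nat.pos_of_ne_zero (Finsupp.mem_support_iff.1 hj)), hτ, not_not]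

/-- The variables outside a prime ideal `P ⊇ I_A^L` form a face of the umbrella: otherwise
Gordan's theorem yields a binomial in `I_A` whose initial form is not in `P`. -/
theorem exists_supports_of_isPrime {A : Matrix (Fin d) (Fin n) ℤ} {L : Fin n → ℚ}
    {P : Ideal (MvPolynomial (Fin n) ℂ)} (hP : P.IsPrime)
    (hle : gradedIdeal L (toricIdeal A) ≤ P)
    {τ : Finset (Fin n)} (hτ : ∀ j, j ∈ τ ↔ MvPolynomial.X j ∉ P) :
    ∃ w, Supports A L w τ := by
  classical
  have key : ∀ u v : Fin n →₀ ℕ, Finsupp.weight A.col u = Finsupp.weight A.col v →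
      Finsupp.weight L u ≤ Finsupp.weight L v → v.support ⊆ τ →
      Finsupp.weight L u = Finsupp.weight L v ∧ u.support ⊆ τ := by
    intro u v h hL hv
    have hvP := (monomial_mem_iff_of_isPrime hP hτ v).not_left.2 hv
    have hL' : Finsupp.weight L u = Finsupp.weight L v := by
      by_contra hne
      exact hvP (hle (monomial_mem_gradedIdeal A L h (lt_of_le_of_ne hL hne)))
    refine ⟨hL', by_contra fun hu => hvP ?_⟩
    have h1 := hle (monomial_sub_mem_gradedIdeal A L h hL')
    exact (Submodule.sub_mem_iff_right P ((monomial_mem_iff_of_isPrime hP hτ u).2 hu)).1 h1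
  let p : Fin n → HomCoord d := fun j => (ratCol A j, L j)
  let x : Option (Fin n) → HomCoord d := fun o => o.elim (0, 1) p
  let s : Finset (Option (Fin n)) := Finset.insertNone τᶜ
  obtain ⟨ψ, hψW, hψ⟩ := exists_dual_pos_of_forall_relation_trivial x s
    (Submodule.span ℚ (Set.range fun j : τ => p j)) (by
      intro c hc hmem
      obtain ⟨b, hb⟩ := (Submodule.mem_span_range_iff_exists_fun ℚ).1 hmem
      let z : Fin n → ℚ := fun j => if hj : j ∈ τ then - b ⟨j, hj⟩ else c (some j)
      have hz : c none • ((0, 1) : HomCoord d) + ∑ j, z j • p j = 0 := by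
        have h1 : ∑ j, z j • p j = ∑ j ∈ τᶜ, c (some j) • p j - ∑ j : τ, b j • p j := by
          rw [← Finset.sum_add_sum_compl τ, ← Finset.sum_coe_sort τ, add_comm, sub_eq_add_neg,
            ← Finset.sum_neg_distrib]
          congr 1
          · refine Finset.sum_congr rfl fun j hj => ?_
            simp [z, Finset.mem_compl.1 hj]
          · refine Finset.sum_congr rfl fun j _ => ?_
            simp [z]
        rw [h1, hb]
        simp [s, x, Finset.sum_insertNone]
      obtain ⟨N, hN, m, hm⟩ := exists_int_multiple z
      have hN' : (0 : ℚ) < N := Nat.cast_pos.2 hN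
      let u : Fin n →₀ ℕ := Finsupp.equivFunOnFinite.symm fun j => (m j).toNat
      let v : Fin n →₀ ℕ := Finsupp.equivFunOnFinite.symm fun j => (-m j).toNat
      have huv : ∀ j, ((u j : ℤ) - v j) = m j := fun j => by simp [u, v]
      have huv' : ∀ j, ((u j : ℚ) - v j) = N * z j := fun j => by
        rw [← hm, ← huv]; push_cast; ring
      have hdeg : Finsupp.weight A.col u = Finsupp.weight A.col v := by
        rw [weight_col_apply, weight_col_apply, ← sub_eq_zero, ← Matrix.mulVec_sub]
        ext i
        have h1 := congrFun (congrArg Prod.fst hz) i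
        simp only [Prod.fst_add, Prod.smul_fst, smul_zero, zero_add, Prod.fst_sum, Prod.fst_zero,
          Finset.sum_apply, Pi.smul_apply, Pi.zero_apply, p, ratCol, smul_eq_mul] at h1
        have h2 : (((A.mulVec ((fun j => (u j : ℤ)) - fun j => (v j : ℤ))) i : ℤ) : ℚ) =
            N * ∑ j, z j * A i j := by
          simp only [Matrix.mulVec, dotProduct, Pi.sub_apply, huv]
          push_cast
          rw [Finset.mul_sum]
          refine Finset.sum_congr rfl fun j _ => ?_
          rw [hm]; ring
        rw [h1, mul_zero] at h2
        exact_mod_cast h2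
      have hwt : Finsupp.weight L u - Finsupp.weight L v = - (N * c none) := by
        have h1 := congrArg Prod.snd hz
        simp only [Prod.snd_add, Prod.smul_snd, Prod.snd_sum, Prod.snd_zero, p,
          smul_eq_mul] at h1
        rw [weight_eq_sum, weight_eq_sum, ← Finset.sum_sub_distrib]
        have : ∀ j, (u j : ℚ) * L j - v j * L j = N * (z j * L j) := fun j => by
          rw [← sub_mul, huv', mul_assoc]
        rw [Finset.sum_congr rfl fun j _ => this j, ← Finset.mul_sum]
        linear_combination N * h1
      have hcn : 0 ≤ c none := hc none (by simp [s])
      have hv : v.support ⊆ τ := by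
        intro j hj
        by_contra hjτ
        have h0 : 0 ≤ c (some j) := hc (some j) (by simp [s, hjτ])
        have h1 : (0 : ℚ) ≤ m j := by
          rw [hm]
          simp only [z, hjτ, dif_neg, not_false_eq_true]
          positivity
        have h2 : 0 ≤ m j := by exact_mod_cast h1
        have h3 : v j = 0 := by simp [v, h2]
        exact Finsupp.mem_support_iff.1 hj h3
      obtain ⟨hLuv, hu⟩ := key u v hdeg (by nlinarith) hv
      intro i hi
      rcases i with _ | j
      · rw [hLuv, sub_self] at hwt
        have : (N : ℚ) * c none = 0 := by linarith
        exact (mul_eq_zero.1 this).resolve_left hN'.ne'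
      · have hjτ : j ∉ τ := by simpa [s] using hi
        have h1 : u j = 0 := Finsupp.notMem_support_iff.1 fun h => hjτ (hu h)
        have h2 : v j = 0 := Finsupp.notMem_support_iff.1 fun h => hjτ (hv h)
        have h3 := huv' j
        rw [h1, h2] at h3
        simp only [z, hjτ, dif_neg, not_false_eq_true, Nat.cast_zero, sub_zero] at h3
        exact (mul_eq_zero.1 h3.symm).resolve_left hN'.ne')
  have ho : 0 < ψ (0, 1) := hψ none (by simp [s])
  obtain ⟨w, hw'⟩ := exists_eq_mul_affineForm ψ ho.ne'
  have hw : ∀ j, ψ (p j) = ψ (0, 1) * (L j - w (ratCol A j)) := fun j => hw' (p j)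
  refine ⟨w, fun j hj => ?_, fun j hj => ?_⟩
  · have h1 := hψW (p j) (Submodule.subset_span ⟨⟨j, hj⟩, rfl⟩)
    rw [hw] at h1
    linarith [(mul_eq_zero.1 h1).resolve_left ho.ne']
  · have h1 : 0 < ψ (p j) := hψ (some j) (by simp [s, hj])
    rw [hw] at h1
    linarith [pos_of_mul_pos_right h1 ho.le]

theorem Supports.faceIdeal_le_of_isPrime {A : Matrix (Fin d) (Fin n) ℤ} {L : Fin n → ℚ}
    {w : (Fin d → ℚ) →ₗ[ℚ] ℚ} {τ : Finset (Fin n)} (h : Supports A L w τ)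
    {P : Ideal (MvPolynomial (Fin n) ℂ)} (hle : gradedIdeal L (toricIdeal A) ≤ P)
    (hτ : ∀ j, j ∈ τ ↔ MvPolynomial.X j ∉ P) : faceIdeal A τ ≤ P := by
  refine faceIdeal_le_of A (fun j hj => not_not.1 fun h => hj ((hτ j).2 h))
    fun u v hu hv huv => hle (monomial_sub_mem_gradedIdeal A L huv ?_)
  have hwt := fun (u : Fin n →₀ ℕ) (hu : u.support ⊆ τ) =>
    (sum_mul_eq_iff_support_subset h.eq h.lt).2 hu
  rw [weight_eq_sum, weight_eq_sum, ← hwt u hu, ← hwt v hv, ← apply_ratVec_weight,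
    ← apply_ratVec_weight, huv]

/-- The graded primes over `I_A^L` are the ideals `I_A^τ` of the index sets `τ` that are supported
by a linear form. -/
theorem isPrime_and_isGradedIdeal_and_le_iff {A : Matrix (Fin d) (Fin n) ℤ} {L : Fin n → ℚ}
    {P : Ideal (MvPolynomial (Fin n) ℂ)} :
    (P.IsPrime ∧ IsGradedIdeal A P ∧ gradedIdeal L (toricIdeal A) ≤ P) ↔
      ∃ w τ, Supports A L w τ ∧ P = faceIdeal A τ := by
  classical
  constructor
  · rintro ⟨hP, hgr, hle⟩
    let τ : Finset (Fin n) := Finset.univ.filter fun j => MvPolynomial.X j ∉ P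
    have hτ : ∀ j, j ∈ τ ↔ MvPolynomial.X j ∉ P := fun j => by simp [τ]
    obtain ⟨w, hw⟩ := exists_supports_of_isPrime hP hle hτ
    exact ⟨w, τ, hw, eq_faceIdeal_of_isGradedIdeal A hgr (hw.faceIdeal_le_of_isPrime hle hτ)
      fun u hu => (monomial_mem_iff_of_isPrime hP hτ u).not_left.2 hu⟩
  · rintro ⟨w, τ, hw, rfl⟩
    rw [faceIdeal_eq_ker]
    exact ⟨inferInstance, isGradedIdeal_ker_faceMap A τ, hw.gradedIdeal_le_ker⟩

/-! ### Facets -/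

theorem span_ratCol_eq_top {A : Matrix (Fin d) (Fin n) ℤ}
    (hZ : AddSubgroup.closure (Set.range A.col) = ⊤) :
    Submodule.span ℚ (Set.range (ratCol A)) = ⊤ := by
  have h1 : ∀ b, ratVec d b ∈ Submodule.span ℚ (Set.range (ratCol A)) := fun b => by
    have hb : b ∈ AddSubgroup.closure (Set.range A.col) := hZ ▸ AddSubgroup.mem_top b
    induction hb using AddSubgroup.closure_induction with
    | mem b hb =>
      obtain ⟨j, rfl⟩ := hb
      exact Submodule.subset_span ⟨j, rfl⟩
    | zero => rw [map_zero]; exact zero_mem _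
    | add b c _ _ hb hc => rw [map_add]; exact add_mem hb hc
    | neg b _ hb => rw [map_neg]; exact neg_mem hb
  refine eq_top_iff.2 fun q _ => ?_
  have h2 : q = ∑ i, q i • ratVec d (Pi.single i 1) := by
    ext k
    simp [ratVec, Pi.single_apply, Finset.sum_apply]
  rw [h2]
  exact Submodule.sum_mem _ fun i _ => Submodule.smul_mem _ _ (h1 _)

/-- Every supported index set lies in one of full dimension: a supporting form can be moved along
any direction vanishing on `τ` until it meets a further column. -/
theorem Supports.exists_facet {A : Matrix (Fin d) (Fin n) ℤ}
    (hZ : AddSubgroup.closure (Set.range A.col) = ⊤) {L : Fin n → ℚ}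
    {w : (Fin d → ℚ) →ₗ[ℚ] ℚ} {τ : Finset (Fin n)} (h : Supports A L w τ) :
    ∃ w' τ', Supports A L w' τ' ∧ τ ⊆ τ' ∧ dimCols A τ' = (d : ℤ) - 1 := by
  classical
  obtain ⟨τ', hττ', ⟨w', hw'⟩, hmax⟩ := Set.Finite.exists_le_maximal
    (Set.toFinite {τ | ∃ w, Supports A L w τ}) ⟨w, h⟩
  refine ⟨w', τ', hw', hττ', ?_⟩
  suffices htop : Submodule.span ℚ (ratCol A '' (τ' : Set (Fin n))) = ⊤ by
    rw [dimCols, htop, finrank_top, Module.finrank_fin_fun]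
  by_contra htop
  obtain ⟨v, hv0, hvτ⟩ := Submodule.exists_le_ker_of_lt_top _ (lt_top_iff_ne_top.2 htop)
  obtain ⟨v, hvτ, j₁, hj₁⟩ : ∃ v : (Fin d → ℚ) →ₗ[ℚ] ℚ, (∀ j ∈ τ', v (ratCol A j) = 0) ∧
      ∃ j, 0 < v (ratCol A j) := by
    have h1 : ∀ j ∈ τ', v (ratCol A j) = 0 := fun j hj =>
      hvτ (Submodule.subset_span ⟨j, hj, rfl⟩)
    obtain ⟨j, hj⟩ : ∃ j, v (ratCol A j) ≠ 0 := by
      by_contra! hall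
      refine hv0 (LinearMap.ext_on_range (span_ratCol_eq_top hZ) fun j => ?_)
      rw [hall j, LinearMap.zero_apply]
    rcases lt_or_gt_of_ne hj with hj | hj
    · exact ⟨-v, fun j hj => by simp [h1 j hj], j, by simpa using hj⟩
    · exact ⟨v, h1, j, hj⟩
  obtain ⟨j₀, hj₀, hmin⟩ := Finset.exists_min_image
    (Finset.univ.filter fun j => 0 < v (ratCol A j))
    (fun j => (L j - w' (ratCol A j)) / v (ratCol A j)) ⟨j₁, by simpa using hj₁⟩
  replace hj₀ : 0 < v (ratCol A j₀) := by simpa using hj₀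
  have hj₀τ : j₀ ∉ τ' := fun hj => hj₀.ne' (hvτ j₀ hj)
  set t := (L j₀ - w' (ratCol A j₀)) / v (ratCol A j₀) with ht
  have ht0 : 0 ≤ t := div_nonneg (sub_nonneg.2 (hw'.le j₀)) hj₀.le
  have hle : ∀ j, (w' + t • v) (ratCol A j) ≤ L j := fun j => by
    simp only [LinearMap.add_apply, LinearMap.smul_apply, smul_eq_mul]
    rcases le_or_gt (v (ratCol A j)) 0 with hj | hj
    · linarith [hw'.le j, mul_nonpos_of_nonneg_of_nonpos ht0 hj]
    · have := hmin j (by simpa using hj)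
      rw [le_div_iff₀ hj] at this
      linarith
  have hsub := hmax (y := Finset.univ.filter fun j => (w' + t • v) (ratCol A j) = L j)
    ⟨w' + t • v, by simp, fun j hj => lt_of_le_of_ne (hle j) (by simpa using hj)⟩
    (fun j hj => by simp [hvτ j hj, hw'.eq j hj])
  refine hj₀τ (hsub ?_)
  simp only [Finset.mem_filter, Finset.mem_univ, true_and, LinearMap.add_apply,
    LinearMap.smul_apply, smul_eq_mul, ht]
  field_simp
  ring

/-! ### The graded toric ring as a quotient of the polynomial ring -/

theorem weightedHomogeneousComponent_monomial {σ M R : Type*} [CommSemiring R] [AddCommMonoid M]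
    [DecidableEq M] (w : σ → M) (k : M) (u : σ →₀ ℕ) (c : R) :
    MvPolynomial.weightedHomogeneousComponent w k (MvPolynomial.monomial u c) =
      if k = Finsupp.weight w u then MvPolynomial.monomial u c else 0 :=
  MvPolynomial.weightedHomogeneousComponent_of_mem
    (MvPolynomial.isWeightedHomogeneous_monomial _ u c rfl)

theorem weightedHomogeneousComponent_comp {σ M R : Type*} [CommSemiring R] [AddCommMonoid M]
    [DecidableEq M] (w : σ → M) (k l : M) (f : MvPolynomial σ R) :
    MvPolynomial.weightedHomogeneousComponent w k
        (MvPolynomial.weightedHomogeneousComponent w l f) =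
      if k = l then MvPolynomial.weightedHomogeneousComponent w l f else 0 :=
  MvPolynomial.weightedHomogeneousComponent_of_mem
    (MvPolynomial.weightedHomogeneousComponent_isWeightedHomogeneous _ _)

theorem weightedHomogeneousComponent_mem_weightFilt (L : Fin n → ℚ) (k : ℚ)
    (f : MvPolynomial (Fin n) ℂ) :
    MvPolynomial.weightedHomogeneousComponent L k f ∈ weightFilt L k := by
  classical
  induction f using MvPolynomial.induction_on' with
  | monomial u c =>
    rw [weightedHomogeneousComponent_monomial]
    split_ifs with h
    · have : MvPolynomial.monomial u c = c • (MvPolynomial.monomial u 1 :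
        MvPolynomial (Fin n) ℂ) := by simp [MvPolynomial.smul_monomial]
      rw [this]
      exact Submodule.smul_mem _ _ (monomial_mem_weightFilt L h.ge)
    · exact zero_mem _
  | add f g hf hg => rw [map_add]; exact add_mem hf hg

theorem weightedHomogeneousComponent_eq_zero_of_mem_filtLT (L : Fin n → ℚ) {k : ℚ}
    {f : MvPolynomial (Fin n) ℂ} (hf : f ∈ filtLT (weightFilt L) k) :
    MvPolynomial.weightedHomogeneousComponent L k f = 0 := by
  classical
  have h : filtLT (weightFilt L) k ≤
      LinearMap.ker (MvPolynomial.weightedHomogeneousComponent (R := ℂ) L k) := by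
    refine iSup_le fun i => Submodule.span_le.2 ?_
    rintro _ ⟨u, hu, rfl⟩
    have hi : (i : ℚ) < k := i.2
    rw [SetLike.mem_coe, LinearMap.mem_ker, weightedHomogeneousComponent_monomial,
      if_neg (hu.trans_lt hi).ne']
  exact h hf

theorem sub_weightedHomogeneousComponent_mem_filtLT (L : Fin n → ℚ) {k : ℚ}
    {f : MvPolynomial (Fin n) ℂ} (hf : f ∈ weightFilt L k) :
    f - MvPolynomial.weightedHomogeneousComponent L k f ∈ filtLT (weightFilt L) k := by
  classical
  have h : weightFilt L k ≤ (filtLT (weightFilt L) k).comap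
      (LinearMap.id - MvPolynomial.weightedHomogeneousComponent (R := ℂ) L k) := by
    refine Submodule.span_le.2 ?_
    rintro _ ⟨u, hu, rfl⟩
    simp only [SetLike.mem_coe, Submodule.mem_comap, LinearMap.sub_apply, LinearMap.id_apply,
      weightedHomogeneousComponent_monomial]
    split_ifs with hk
    · rw [sub_self]; exact zero_mem _
    · rw [sub_zero]
      exact Submodule.mem_iSup_of_mem (p := fun i : Set.Iio k => weightFilt L i)
        ⟨Finsupp.weight L u, lt_of_le_of_ne hu (Ne.symm hk)⟩ (monomial_mem_weightFilt L le_rfl)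
  exact h hf

theorem filtLT_le (L : Fin n → ℚ) (k : ℚ) : filtLT (weightFilt L) k ≤ weightFilt L k := by
  refine iSup_le fun i => Submodule.span_mono ?_
  rintro _ ⟨u, hu, rfl⟩
  exact ⟨u, hu.trans (le_of_lt i.2), rfl⟩

theorem filtLT_toricFilt (A : Matrix (Fin d) (Fin n) ℤ) (L : Fin n → ℚ) (k : ℚ) :
    filtLT (toricFilt A L) k = (filtLT (weightFilt L) k).map
      (Ideal.Quotient.mkₐ ℂ (toricIdeal A)).toLinearMap := by
  rw [filtLT, filtLT, Submodule.map_iSup]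
  rfl

/-- The map from `R` to the Rees algebra of `S_A` sending `∂_j` to `∂_j T^{L_j}`. -/
def toRees (A : Matrix (Fin d) (Fin n) ℤ) (L : Fin n → ℚ) :
    MvPolynomial (Fin n) ℂ →ₐ[ℂ] rees (toricFilt A L) :=
  MvPolynomial.aeval fun j =>
    ⟨AddMonoidAlgebra.single (L j) (Ideal.Quotient.mk (toricIdeal A) (MvPolynomial.X j)),
      fun m => by
        classical
        rw [AddMonoidAlgebra.coeff_single, Finsupp.single_apply]
        split_ifs with h
        · exact h ▸ ⟨MvPolynomial.X j, X_mem_weightFilt L j, rfl⟩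
        · exact Submodule.zero_mem _⟩

theorem toGradedToricRing_eq (A : Matrix (Fin d) (Fin n) ℤ) (L : Fin n → ℚ)
    (f : MvPolynomial (Fin n) ℂ) : toGradedToricRing A L f =
      Ideal.Quotient.mk (reesLT (toricFilt A L)) (toRees A L f) := by
  have : toGradedToricRing A L =
      (Ideal.Quotient.mkₐ ℂ (reesLT (toricFilt A L))).comp (toRees A L) := by
    refine MvPolynomial.algHom_ext fun j => ?_
    simp only [toGradedToricRing, toRees, MvPolynomial.aeval_X, AlgHom.comp_apply]
    rfl
  rw [this]
  rfl

theorem coeff_toRees (A : Matrix (Fin d) (Fin n) ℤ) (L : Fin n → ℚ)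
    (f : MvPolynomial (Fin n) ℂ) (k : ℚ) : (toRees A L f).1.coeff k =
      Ideal.Quotient.mk (toricIdeal A) (MvPolynomial.weightedHomogeneousComponent L k f) := by
  classical
  let G : MvPolynomial (Fin n) ℂ →ₐ[ℂ] AddMonoidAlgebra (ToricRing A) ℚ :=
    (rees (toricFilt A L)).val.comp (toRees A L)
  have hG : G = MvPolynomial.aeval fun j =>
      AddMonoidAlgebra.single (L j) (Ideal.Quotient.mk (toricIdeal A) (MvPolynomial.X j)) := by
    refine MvPolynomial.algHom_ext fun j => ?_
    simp [G, toRees]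
  have hmon : ∀ u c, G (MvPolynomial.monomial u c) = AddMonoidAlgebra.single (Finsupp.weight L u)
      (Ideal.Quotient.mk (toricIdeal A) (MvPolynomial.monomial u c)) := by
    intro u c
    rw [hG, MvPolynomial.aeval_monomial, Finsupp.prod,
      Finset.prod_congr rfl fun j hj => AddMonoidAlgebra.single_pow _ _ _,
      AddMonoidAlgebra.prod_single, AddMonoidAlgebra.coe_algebraMap, Function.comp_apply,
      AddMonoidAlgebra.single_mul_single, zero_add, Finsupp.weight_apply, Finsupp.sum]
    congr 1
    rw [MvPolynomial.monomial_eq, map_mul, Finsupp.prod, map_prod]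
    simp only [map_pow]
    rfl
  change (G f).coeff k = _
  induction f using MvPolynomial.induction_on' with
  | monomial u c =>
    rw [hmon, weightedHomogeneousComponent_monomial, AddMonoidAlgebra.coeff_single,
      Finsupp.single_apply]
    by_cases h : Finsupp.weight L u = k
    · rw [if_pos h, if_pos h.symm]
    · rw [if_neg h, if_neg (Ne.symm h), map_zero]
  | add f g hf hg => rw [map_add, AddMonoidAlgebra.coeff_add, Finsupp.add_apply, hf, hg, map_add,
      map_add]

theorem toGradedToricRing_surjective (A : Matrix (Fin d) (Fin n) ℤ) (L : Fin n → ℚ) :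
    Function.Surjective (toGradedToricRing A L) := by
  classical
  intro q
  obtain ⟨⟨g, hg⟩, rfl⟩ := Ideal.Quotient.mk_surjective q
  have hg' : ∀ k, ∃ f ∈ weightFilt L k, Ideal.Quotient.mk (toricIdeal A) f = g.coeff k := hg
  choose f hf hfg using hg'
  refine ⟨∑ k ∈ g.coeff.support, MvPolynomial.weightedHomogeneousComponent L k (f k), ?_⟩
  rw [toGradedToricRing_eq, Ideal.Quotient.eq]
  intro k
  change (toRees A L _).1.coeff k - g.coeff k ∈ _
  rw [coeff_toRees, map_sum]
  simp only [weightedHomogeneousComponent_comp]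
  rw [Finset.sum_ite_eq]
  split_ifs with hk
  · rw [filtLT_toricFilt, ← hfg k]
    refine ⟨_, neg_mem (sub_weightedHomogeneousComponent_mem_filtLT L (hf k)), ?_⟩
    simp
  · rw [Finsupp.notMem_support_iff.1 hk]
    simp

theorem ker_toGradedToricRing (A : Matrix (Fin d) (Fin n) ℤ) (L : Fin n → ℚ) :
    RingHom.ker (toGradedToricRing A L) = gradedIdeal L (toricIdeal A) := by
  classical
  have hker : ∀ f, f ∈ RingHom.ker (toGradedToricRing A L) ↔ ∀ k,
      Ideal.Quotient.mk (toricIdeal A) (MvPolynomial.weightedHomogeneousComponent L k f) ∈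
        filtLT (toricFilt A L) k := by
    intro f
    rw [RingHom.mem_ker, toGradedToricRing_eq, Ideal.Quotient.eq_zero_iff_mem]
    exact forall_congr' fun k => by rw [coeff_toRees]
  refine le_antisymm (fun f hf => ?_) (Ideal.span_le.2 ?_)
  · rw [hker] at hf
    rw [← MvPolynomial.sum_weightedHomogeneousComponent L f]
    refine finsum_induction (fun g => g ∈ gradedIdeal L (toricIdeal A)) (zero_mem _)
      (fun _ _ => add_mem) fun k => ?_
    have hk := hf k
    rw [filtLT_toricFilt] at hk
    obtain ⟨g, hg, hgf⟩ := hk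
    -- subtracting lower-order terms from the component gives an element of `I_A`
    refine Ideal.subset_span ⟨k, MvPolynomial.weightedHomogeneousComponent L k f - g, ?_,
      sub_mem (weightedHomogeneousComponent_mem_weightFilt L k f) (filtLT_le L k hg), ?_⟩
    · exact Ideal.Quotient.eq.1 hgf.symm
    · rw [map_sub, weightedHomogeneousComponent_comp, if_pos rfl,
        weightedHomogeneousComponent_eq_zero_of_mem_filtLT L hg, sub_zero]
  · rintro _ ⟨k, f, hfI, hf, rfl⟩
    rw [SetLike.mem_coe, hker]
    intro l
    rw [weightedHomogeneousComponent_comp]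
    split_ifs with h
    · subst h
      rw [filtLT_toricFilt]
      refine ⟨_, neg_mem (sub_weightedHomogeneousComponent_mem_filtLT L hf), ?_⟩
      simp [Ideal.Quotient.eq_zero_iff_mem.2 hfI]
    · rw [map_zero]; exact zero_mem _

/-- The `ℂ`-valued points of a quotient of `R` are the zeros of its kernel. -/
theorem range_algHom_eq_zeroLocus_ker {S : Type*} [CommRing S] [Algebra ℂ S]
    (π : MvPolynomial (Fin n) ℂ →ₐ[ℂ] S) (hπ : Function.Surjective π) :
    (Set.range fun (φ : S →ₐ[ℂ] ℂ) (j : Fin n) => φ (π (MvPolynomial.X j))) =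
      MvPolynomial.zeroLocus ℂ (RingHom.ker π) := by
  ext ξ
  rw [MvPolynomial.mem_zeroLocus_iff]
  constructor
  · rintro ⟨φ, rfl⟩ f hf
    have : MvPolynomial.aeval (fun j => φ (π (MvPolynomial.X j))) = φ.comp π :=
      MvPolynomial.algHom_ext fun j => by simp
    rw [this, AlgHom.comp_apply, RingHom.mem_ker.1 hf, map_zero]
  · intro h
    refine ⟨AlgHom.liftOfSurjective π hπ (MvPolynomial.aeval ξ) fun f hf => h f hf,
      funext fun j => ?_⟩
    exact (AlgHom.liftOfSurjective_apply π hπ _ _ _).trans (MvPolynomial.aeval_X ξ j)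

theorem specPoints_eq_zeroLocus (A : Matrix (Fin d) (Fin n) ℤ) (L : Fin n → ℚ) :
    specPoints A L = MvPolynomial.zeroLocus ℂ (gradedIdeal L (toricIdeal A)) := by
  rw [← ker_toGradedToricRing]
  exact range_algHom_eq_zeroLocus_ker (S := GradedToricRing A L) (toGradedToricRing A L)
    (toGradedToricRing_surjective A L)

/-! ### Torus orbits and their closures -/

/-- The character `t ↦ t^b` of the torus. -/
def torusChar (b : Fin d → ℤ) : (Fin d → ℂˣ) →* ℂ where
  toFun t := ((∏ i, t i ^ b i : ℂˣ) : ℂ)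
  map_one' := by simp
  map_mul' s t := by simp [mul_zpow, Finset.prod_mul_distrib]

theorem torusChar_apply (b : Fin d → ℤ) (t : Fin d → ℂˣ) :
    torusChar b t = ((∏ i, t i ^ b i : ℂˣ) : ℂ) := rfl

theorem torusChar_injective : Function.Injective (torusChar (d := d)) := by
  classical
  intro b c h
  ext i
  -- compare the values at the point with entry `2` at `i` and `1` elsewhere
  have h2 : (2 : ℂ) ≠ 0 := two_ne_zero
  have h1 := DFunLike.congr_fun h (Pi.mulSingle i (Units.mk0 2 h2))
  have key : ∀ b : Fin d → ℤ,
      torusChar b (Pi.mulSingle i (Units.mk0 2 h2)) = (2 : ℂ) ^ b i := by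
    intro b
    rw [torusChar_apply, Finset.prod_eq_single i]
    · simp
    · intro j _ hj
      simp [hj]
    · simp
  rw [key, key] at h1
  have h3 : ((2 : ℝ) ^ b i) = (2 : ℝ) ^ c i := by
    refine Complex.ofReal_injective ?_
    rw [Complex.ofReal_zpow, Complex.ofReal_zpow]
    exact h1
  exact zpow_right_injective₀ (by norm_num) (by norm_num) h3

/-- Evaluation of Laurent polynomials at a point of the torus. -/
def torusEval (t : Fin d → ℂˣ) : AddMonoidAlgebra ℂ (Fin d → ℤ) →ₐ[ℂ] ℂ :=
  AddMonoidAlgebra.lift ℂ ℂ (Fin d → ℤ)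
    { toFun := fun b => torusChar b.toAdd t
      map_one' := by simp [torusChar_apply]
      map_mul' := fun b c => by simp [torusChar_apply, zpow_add, Finset.prod_mul_distrib] }

theorem torusEval_single (t : Fin d → ℂˣ) (b : Fin d → ℤ) (c : ℂ) :
    torusEval t (AddMonoidAlgebra.single b c) = c * torusChar b t := by
  simp [torusEval]

theorem torusEval_apply (t : Fin d → ℂˣ) (f : AddMonoidAlgebra ℂ (Fin d → ℤ)) :
    torusEval t f = f.coeff.sum fun b c => c * torusChar b t := by
  conv_lhs => rw [← AddMonoidAlgebra.sum_coeff_single f]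
  rw [Finsupp.sum, map_sum]
  exact Finset.sum_congr rfl fun b _ => torusEval_single t b _

/-- A Laurent polynomial that vanishes on the torus is zero, by the linear independence of
characters. -/
theorem eq_zero_of_forall_torusEval_eq_zero {f : AddMonoidAlgebra ℂ (Fin d → ℤ)}
    (h : ∀ t, torusEval t f = 0) : f = 0 := by
  have hli := (linearIndependent_monoidHom (Fin d → ℂˣ) ℂ).comp _ (torusChar_injective (d := d))
  rw [linearIndependent_iff] at hli
  refine AddMonoidAlgebra.coeff_eq_zero.1 (hli f.coeff (funext fun t => ?_))
  rw [Finsupp.linearCombination_apply, Finsupp.sum, Finset.sum_apply, Pi.zero_apply, ← h t,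
    torusEval_apply]
  rfl

theorem torusAct_indicator (A : Matrix (Fin d) (Fin n) ℤ) (τ : Finset (Fin n))
    (t : Fin d → ℂˣ) (j : Fin n) : torusAct A t (fun j => if j ∈ τ then 1 else 0) j =
      if j ∈ τ then torusChar (A.col j) t else 0 := by
  simp only [torusAct, mul_ite, mul_one, mul_zero]
  rfl

theorem aeval_torusAct_indicator (A : Matrix (Fin d) (Fin n) ℤ) (τ : Finset (Fin n))
    (t : Fin d → ℂˣ) (f : MvPolynomial (Fin n) ℂ) :
    MvPolynomial.aeval (torusAct A t fun j => if j ∈ τ then 1 else 0) f =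
      torusEval t (faceMap A τ f) := by
  have : MvPolynomial.aeval (torusAct A t fun j => if j ∈ τ then 1 else 0) =
      (torusEval t).comp (faceMap A τ) := by
    refine MvPolynomial.algHom_ext fun j => ?_
    rw [MvPolynomial.aeval_X, torusAct_indicator, AlgHom.comp_apply, faceMap,
      MvPolynomial.aeval_X]
    split_ifs
    · rw [torusEval_single, one_mul]
    · rw [map_zero]
  rw [this, AlgHom.comp_apply]

theorem ne_zero_iff_of_mem_orbit {A : Matrix (Fin d) (Fin n) ℤ} {τ : Finset (Fin n)}
    {ξ : Fin n → ℂ} (hξ : ξ ∈ orbit A τ) (j : Fin n) : ξ j ≠ 0 ↔ j ∈ τ := by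
  obtain ⟨t, rfl⟩ := hξ
  dsimp only
  rw [torusAct_indicator, torusChar_apply]
  split_ifs with h <;> simp [h, -Units.coe_prod]

theorem orbit_nonempty (A : Matrix (Fin d) (Fin n) ℤ) (τ : Finset (Fin n)) :
    (orbit A τ).Nonempty := Set.range_nonempty _

theorem vanishingIdeal_orbit (A : Matrix (Fin d) (Fin n) ℤ) (τ : Finset (Fin n)) :
    MvPolynomial.vanishingIdeal ℂ (orbit A τ) = RingHom.ker (faceMap A τ) := by
  ext f
  rw [MvPolynomial.mem_vanishingIdeal_iff, RingHom.mem_ker]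
  constructor
  · intro h
    exact eq_zero_of_forall_torusEval_eq_zero fun t => by
      rw [← aeval_torusAct_indicator]
      exact h _ ⟨t, rfl⟩
  · rintro h _ ⟨t, rfl⟩
    dsimp only
    rw [aeval_torusAct_indicator, h, map_zero]

theorem zariskiClosure_orbit (A : Matrix (Fin d) (Fin n) ℤ) (τ : Finset (Fin n)) :
    zariskiClosure (orbit A τ) = MvPolynomial.zeroLocus ℂ (RingHom.ker (faceMap A τ)) := by
  rw [zariskiClosure, vanishingIdeal_orbit]

theorem subset_zariskiClosure (C : Set (Fin n → ℂ)) : C ⊆ zariskiClosure C :=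
  MvPolynomial.zeroLocus_vanishingIdeal_le C

/-- A homomorphism to `ℂˣ` from a subgroup of a lattice extends to the lattice, since `ℂˣ` is
divisible; here the subgroup is the image of `f`. -/
theorem exists_extension_complexUnits {M N : Type*} [AddCommGroup M] [AddCommGroup N]
    (f : M →ₗ[ℤ] N) (g : M →ₗ[ℤ] Additive ℂˣ) (hle : LinearMap.ker f ≤ LinearMap.ker g) :
    ∃ h : N →ₗ[ℤ] Additive ℂˣ, ∀ x, h (f x) = g x := by
  have hdiv : ∀ {k : ℕ}, k ≠ 0 → Function.Surjective fun x : Additive ℂˣ => k • x := by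
    intro k hk x
    obtain ⟨z, hz⟩ := IsAlgClosed.exists_pow_nat_eq ((Additive.toMul x : ℂˣ) : ℂ)
      (Nat.pos_of_ne_zero hk)
    have hz0 : z ≠ 0 := by
      rintro rfl
      rw [zero_pow hk] at hz
      exact (Units.ne_zero _) hz.symm
    refine ⟨Additive.ofMul (Units.mk0 z hz0), ?_⟩
    refine Additive.toMul.injective (Units.ext ?_)
    simpa using hz
  let : DivisibleBy (Additive ℂˣ) ℕ := divisibleByOfSMulRightSurj _ _ hdiv
  let : DivisibleBy (Additive ℂˣ) ℤ := AddGroup.divisibleByIntOfDivisibleByNat _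
  obtain ⟨h, hh⟩ := (Module.Baer.of_divisible (Additive ℂˣ)).extension_property
    ((LinearMap.ker f).liftQ f le_rfl)
    (LinearMap.ker_eq_bot.1 (Submodule.ker_liftQ_eq_bot _ _ _ le_rfl))
    ((LinearMap.ker f).liftQ g hle)
  refine ⟨h, fun x => ?_⟩
  simpa using LinearMap.congr_fun hh (Submodule.Quotient.mk x)

/-- The orbit `O_A^τ` consists of the zeros of `I_A^τ` with support `τ`. -/
theorem mem_orbit_of_mem_zeroLocus {A : Matrix (Fin d) (Fin n) ℤ} {τ : Finset (Fin n)}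
    {ξ : Fin n → ℂ} (hξ : ξ ∈ MvPolynomial.zeroLocus ℂ (faceIdeal A τ))
    (hsupp : ∀ j, ξ j ≠ 0 ↔ j ∈ τ) : ξ ∈ orbit A τ := by
  classical
  let x : τ → ℂˣ := fun j => Units.mk0 (ξ j) ((hsupp j).2 j.2)
  obtain ⟨h, hh⟩ := exists_extension_complexUnits
    (Fintype.linearCombination ℤ fun j : τ => A.col j)
    (Fintype.linearCombination ℤ fun j : τ => Additive.ofMul (x j)) (by
      intro z hz
      rw [LinearMap.mem_ker] at hz ⊢
      -- the binomial of `z` vanishes at `ξ`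
      have hz' : (colsSubmatrix A τ).mulVec z = 0 := by
        rw [← hz]
        ext i
        simp [colsSubmatrix, Matrix.mulVec, dotProduct, Fintype.linearCombination_apply, mul_comm]
      have hbox := hξ _ (Ideal.mem_sup_left (Ideal.mem_map_of_mem
        (MvPolynomial.rename (R := ℂ) (Subtype.val : τ → Fin n)).toRingHom
        (Ideal.subset_span ⟨z, hz', rfl⟩)))
      replace hbox : ∏ j, x j ^ (z j).toNat = ∏ j, x j ^ (-z j).toNat := by
        refine Units.ext ?_
        rw [← sub_eq_zero]
        simpa [box, MvPolynomial.aeval_rename, x] using hbox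
      have h1 : ∏ j, x j ^ z j = 1 := by
        have : ∀ j, x j ^ z j = x j ^ (z j).toNat / x j ^ (-z j).toNat := fun j => by
          rw [← zpow_natCast, ← zpow_natCast, div_eq_mul_inv, ← zpow_sub, Int.toNat_sub_toNat_neg]
        rw [Finset.prod_congr rfl fun j _ => this j, Finset.prod_div_distrib, hbox, div_self']
      rw [Fintype.linearCombination_apply]
      refine Additive.toMul.injective ?_
      simpa using h1)
  refine ⟨fun i => (h (Pi.single i 1)).toMul, funext fun j => ?_⟩
  dsimp only
  rw [torusAct_indicator]
  split_ifs with hj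
  · have h1 := hh (Pi.single ⟨j, hj⟩ 1)
    rw [Fintype.linearCombination_apply_single, Fintype.linearCombination_apply_single, one_smul,
      one_smul] at h1
    have h2 : A.col j = ∑ i, A i j • (Pi.single i 1 : Fin d → ℤ) := by
      ext k
      simp [Pi.single_apply, Finset.sum_apply]
    have h3 := congrArg (fun y : Additive ℂˣ => ((Additive.toMul y : ℂˣ) : ℂ)) h1
    simp only [h2, map_sum, map_zsmul] at h3
    rw [torusChar_apply]
    simpa [x] using h3
  · exact (not_not.1 fun h0 => hj ((hsupp j).1 h0)).symm

theorem Supports.zariskiClosure_orbit_subset {A : Matrix (Fin d) (Fin n) ℤ} {L : Fin n → ℚ}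
    {w : (Fin d → ℚ) →ₗ[ℚ] ℚ} {τ : Finset (Fin n)} (h : Supports A L w τ) :
    zariskiClosure (orbit A τ) ⊆ MvPolynomial.zeroLocus ℂ (gradedIdeal L (toricIdeal A)) := by
  rw [zariskiClosure_orbit]
  exact MvPolynomial.zeroLocus_anti_mono h.gradedIdeal_le_ker

theorem exists_supports_of_mem_zeroLocus {A : Matrix (Fin d) (Fin n) ℤ} {L : Fin n → ℚ}
    {ξ : Fin n → ℂ} (hξ : ξ ∈ MvPolynomial.zeroLocus ℂ (gradedIdeal L (toricIdeal A))) :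
    ∃ w τ, Supports A L w τ ∧ ξ ∈ orbit A τ := by
  classical
  let P := MvPolynomial.vanishingIdeal ℂ ({ξ} : Set (Fin n → ℂ))
  have hmem : ∀ f, f ∈ P ↔ MvPolynomial.aeval ξ f = 0 :=
    MvPolynomial.mem_vanishingIdeal_singleton_iff ξ
  have hP : P.IsPrime := inferInstance
  have hle : gradedIdeal L (toricIdeal A) ≤ P := fun f hf => (hmem f).2 (hξ f hf)
  let τ : Finset (Fin n) := Finset.univ.filter fun j => ξ j ≠ 0
  have hτ : ∀ j, j ∈ τ ↔ MvPolynomial.X j ∉ P := fun j => by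
    rw [hmem, MvPolynomial.aeval_X]
    simp [τ]
  obtain ⟨w, hw⟩ := exists_supports_of_isPrime hP hle hτ
  refine ⟨w, τ, hw, mem_orbit_of_mem_zeroLocus (fun f hf => ?_) fun j => by simp [τ]⟩
  exact (hmem f).1 (hw.faceIdeal_le_of_isPrime hle hτ hf)

theorem Supports.orbit_subset_zariskiClosure_iff {A : Matrix (Fin d) (Fin n) ℤ} {L : Fin n → ℚ}
    {w w' : (Fin d → ℚ) →ₗ[ℚ] ℚ} {τ τ' : Finset (Fin n)} (h : Supports A L w τ)
    (h' : Supports A L w' τ') : orbit A τ' ⊆ zariskiClosure (orbit A τ) ↔ τ' ⊆ τ := by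
  constructor
  · intro hsub j hj
    by_contra hjτ
    obtain ⟨ξ, hξ⟩ := orbit_nonempty A τ'
    refine (ne_zero_iff_of_mem_orbit hξ j).2 hj ?_
    have hX : MvPolynomial.X j ∈ MvPolynomial.vanishingIdeal ℂ (orbit A τ) := by
      rw [MvPolynomial.mem_vanishingIdeal_iff]
      intro η hη
      rw [MvPolynomial.aeval_X]
      exact not_not.1 fun h0 => hjτ ((ne_zero_iff_of_mem_orbit hη j).1 h0)
    simpa using hsub hξ _ hX
  · intro hsub
    refine (subset_zariskiClosure _).trans ?_
    rw [zariskiClosure_orbit, zariskiClosure_orbit]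
    exact MvPolynomial.zeroLocus_anti_mono (h.ker_faceMap_anti h' hsub)

/-! ### Faces of the polyhedron and supporting forms -/

theorem chart_mk (l : HomCoord d →ₗ[ℚ] ℚ) (v : HomCoord d) (hv : v ≠ 0) :
    chart l (Projectivization.mk ℚ v hv) = (l v)⁻¹ • v := by
  obtain ⟨a, ha⟩ := Projectivization.exists_smul_eq_mk_rep ℚ v hv
  have ha0 : (a : ℚ) ≠ 0 := a.ne_zero
  rw [chart, ← ha, Units.smul_def, map_smul, smul_eq_mul, mul_inv, smul_smul]
  congr 1
  field_simp

theorem apply_rep_mk_eq_zero_iff (l : HomCoord d →ₗ[ℚ] ℚ) (v : HomCoord d) (hv : v ≠ 0) :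
    l (Projectivization.mk ℚ v hv).rep = 0 ↔ l v = 0 := by
  obtain ⟨a, ha⟩ := Projectivization.exists_smul_eq_mk_rep ℚ v hv
  rw [← ha, Units.smul_def, map_smul, smul_eq_mul, mul_eq_zero_iff_left a.ne_zero]

theorem apply_chart (l : HomCoord d →ₗ[ℚ] ℚ) {p : ProjSpace d} (hp : p ∈ hyperplaneCompl l) :
    l (chart l p) = 1 := by
  rw [chart, map_smul, smul_eq_mul, inv_mul_cancel₀ hp]

theorem chart_injOn (l : HomCoord d →ₗ[ℚ] ℚ) : Set.InjOn (chart l) (hyperplaneCompl l) := by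
  intro p hp q hq h
  rw [← p.mk_rep, ← q.mk_rep, Projectivization.mk_eq_mk_iff']
  refine ⟨l p.rep * (l q.rep)⁻¹, ?_⟩
  have h' : (l p.rep)⁻¹ • p.rep = (l q.rep)⁻¹ • q.rep := h
  rw [mul_smul, ← h', smul_smul, mul_inv_cancel₀ hp, one_smul]

theorem hypForm_ratCol_pos {A : Matrix (Fin d) (Fin n) ℤ} {L : Fin n → ℚ}
    {h : (Fin d → ℚ) →ₗ[ℚ] ℚ} (hh : ∀ j, 0 < h (ratCol A j)) {ε : ℚ} (hε : 0 < ε)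
    (hεL : ∀ j, L j ≠ 0 → ε < |h (ratCol A j) / L j|) (j : Fin n) :
    0 < hypForm h ε (ratCol A j, L j) := by
  change 0 < h (ratCol A j) + ε * L j
  rcases eq_or_ne (L j) 0 with h0 | h0
  · rw [h0, mul_zero, add_zero]
    exact hh j
  · have h1 := hεL j h0
    rw [abs_div, abs_of_pos (hh j), lt_div_iff₀ (abs_pos.2 h0)] at h1
    have h2 : -(ε * |L j|) ≤ ε * L j := by
      rw [← mul_neg]
      exact mul_le_mul_of_nonneg_left (neg_abs_le _) hε.le
    linarith

section Faces

variable {A : Matrix (Fin d) (Fin n) ℤ} {hA : ∀ j, A.col j ≠ 0} {L : Fin n → ℚ}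
  {h : (Fin d → ℚ) →ₗ[ℚ] ℚ} {ε : ℚ}

theorem insert_origin_subset_hyperplaneCompl (hε : 0 < ε)
    (hl : ∀ j, 0 < hypForm h ε (ratCol A j, L j)) :
    insert (origin d) (Set.range (colPoint A hA L)) ⊆ hyperplaneCompl (hypForm h ε) := by
  refine Set.insert_subset ?_ ?_
  · intro h0
    rw [origin, apply_rep_mk_eq_zero_iff] at h0
    simp [hypForm] at h0
    exact hε.ne' h0
  · rintro _ ⟨j, rfl⟩ h0
    rw [colPoint, apply_rep_mk_eq_zero_iff] at h0
    exact (hl j).ne' h0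

theorem subset_polyhedron (hε : 0 < ε) (hl : ∀ j, 0 < hypForm h ε (ratCol A j, L j)) :
    insert (origin d) (Set.range (colPoint A hA L)) ⊆ polyhedron A hA L h ε := fun _ hp =>
  ⟨insert_origin_subset_hyperplaneCompl hε hl hp, subset_convexHull _ _ ⟨_, hp, rfl⟩⟩

/-- In the chart, the points of the polyhedron are nonnegative combinations of the origin `(0, 1)`
and the vectors `(a_j, L_j)`. -/
theorem exists_eq_sum_of_mem_polyhedron (hε : 0 < ε)
    (hl : ∀ j, 0 < hypForm h ε (ratCol A j, L j)) {p : ProjSpace d}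
    (hp : p ∈ polyhedron A hA L h ε) :
    ∃ (r : ℚ) (c : Fin n → ℚ), 0 ≤ r ∧ (∀ j, 0 ≤ c j) ∧ chart (hypForm h ε) p =
      r • ((0, 1) : HomCoord d) + ∑ j, c j • ((ratCol A j, L j) : HomCoord d) := by
  classical
  let S : Set (HomCoord d) := {x | ∃ (r : ℚ) (c : Fin n → ℚ), 0 ≤ r ∧ (∀ j, 0 ≤ c j) ∧ x =
      r • ((0, 1) : HomCoord d) + ∑ j, c j • ((ratCol A j, L j) : HomCoord d)}
  have hS : Convex ℚ S := by
    rintro _ ⟨r, c, hr, hc, rfl⟩ _ ⟨r', c', hr', hc', rfl⟩ a b ha hb -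
    refine ⟨a * r + b * r', fun j => a * c j + b * c' j, by positivity,
      fun j => add_nonneg (mul_nonneg ha (hc j)) (mul_nonneg hb (hc' j)), ?_⟩
    simp only [add_smul, Finset.sum_add_distrib, mul_smul, smul_add, Finset.smul_sum]
    abel
  refine convexHull_min (t := S) ?_ hS hp.2
  rintro _ ⟨q, rfl | ⟨j, rfl⟩, rfl⟩
  · refine ⟨(hypForm h ε (0, 1))⁻¹, 0, ?_, fun _ => le_rfl, ?_⟩
    · simp [hypForm, hε.le]
    · rw [origin, chart_mk]
      simp
  · refine ⟨0, Pi.single j (hypForm h ε (ratCol A j, L j))⁻¹, le_rfl, fun k => ?_, ?_⟩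
    · rw [Pi.single_apply]
      split_ifs
      · exact inv_nonneg.2 (hl j).le
      · exact le_rfl
    · rw [colPoint, chart_mk, Finset.sum_eq_single j]
      · simp
      · intro k _ hk
        simp [hk]
      · simp

theorem affineForm_sum (w : (Fin d → ℚ) →ₗ[ℚ] ℚ) (r : ℚ) (c : Fin n → ℚ) :
    affineForm w (r • ((0, 1) : HomCoord d) + ∑ j, c j • ((ratCol A j, L j) : HomCoord d)) =
      r + ∑ j, c j * (L j - w (ratCol A j)) := by
  rw [map_add, map_smul, map_sum]
  simp only [map_smul, affineForm_apply, smul_eq_mul, map_zero]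
  ring_nf

theorem affineForm_chart_eq_zero_iff (w : (Fin d → ℚ) →ₗ[ℚ] ℚ) {l : HomCoord d →ₗ[ℚ] ℚ}
    {p : ProjSpace d} (hp : p ∈ hyperplaneCompl l) :
    affineForm w (chart l p) = 0 ↔ affineForm w p.rep = 0 := by
  rw [chart, map_smul, smul_eq_mul, mul_eq_zero_iff_left (inv_ne_zero hp)]

variable (A hA L h ε) in
/-- The part of the polyhedron on the hyperplane `s = w(q)`. -/
def faceSet (w : (Fin d → ℚ) →ₗ[ℚ] ℚ) : Set (ProjSpace d) :=
  {p | p ∈ polyhedron A hA L h ε ∧ affineForm w p.rep = 0}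

theorem affineForm_nonneg (hε : 0 < ε) (hl : ∀ j, 0 < hypForm h ε (ratCol A j, L j))
    {w : (Fin d → ℚ) →ₗ[ℚ] ℚ} (hw : ∀ j, w (ratCol A j) ≤ L j) {p : ProjSpace d}
    (hp : p ∈ polyhedron A hA L h ε) : 0 ≤ affineForm w (chart (hypForm h ε) p) := by
  obtain ⟨r, c, hr, hc, hx⟩ := exists_eq_sum_of_mem_polyhedron hε hl hp
  rw [hx, affineForm_sum]
  exact add_nonneg hr (Finset.sum_nonneg fun j _ => mul_nonneg (hc j) (sub_nonneg.2 (hw j)))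

theorem continuous_linearMap_homCoord (ψ : HomCoord d →ₗ[ℚ] ℚ) : Continuous ψ := by
  have : ⇑ψ = fun v => ψ.comp (LinearMap.inl ℚ (Fin d → ℚ) ℚ) v.1 + v.2 * ψ (0, 1) := by
    ext v
    have hv : v = (v.1, 0) + v.2 • (0, 1) := by ext <;> simp
    conv_lhs => rw [hv, map_add, map_smul]
    rfl
  rw [this]
  exact ((LinearMap.continuous_on_pi _).comp continuous_fst).add
    (continuous_snd.mul continuous_const)

theorem faceSet_mem_umbrella (hε : 0 < ε) (hl : ∀ j, 0 < hypForm h ε (ratCol A j, L j))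
    {w : (Fin d → ℚ) →ₗ[ℚ] ℚ} (hw : ∀ j, w (ratCol A j) ≤ L j) :
    faceSet A hA L h ε w ∈ umbrella A hA L h ε := by
  refine ⟨⟨fun p hp => hp.1, ?_⟩, ?_⟩
  · rintro ⟨_, p₀, hp₀, rfl⟩
    refine ⟨⟨-affineForm w, continuous_linearMap_homCoord _⟩, ?_⟩
    have hzero : ∀ p ∈ polyhedron A hA L h ε, p ∈ faceSet A hA L h ε w ↔
        affineForm w (chart (hypForm h ε) p) = 0 := fun p hp => by
      rw [affineForm_chart_eq_zero_iff w hp.1]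
      exact ⟨fun h => h.2, fun h => ⟨hp, h⟩⟩
    ext x
    constructor
    · rintro ⟨p, hp, rfl⟩
      refine ⟨⟨p, hp.1, rfl⟩, ?_⟩
      rintro _ ⟨q, hq, rfl⟩
      have h1 := (hzero p hp.1).1 hp
      have h2 := affineForm_nonneg hε hl hw hq
      change -affineForm w (chart _ q) ≤ -affineForm w (chart _ p)
      linarith
    · rintro ⟨⟨p, hp, rfl⟩, hmax⟩
      refine ⟨p, (hzero p hp).2 ?_, rfl⟩
      have h1 : -affineForm w (chart _ p₀) ≤ -affineForm w (chart _ p) :=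
        hmax _ ⟨p₀, hp₀.1, rfl⟩
      have h2 := (hzero p₀ hp₀.1).1 hp₀
      have h3 := affineForm_nonneg hε hl hw hp
      linarith
  · rintro ⟨-, h0⟩
    rw [origin, apply_rep_mk_eq_zero_iff] at h0
    simp at h0

/-- Every face of the umbrella is cut out by a hyperplane `s = w(q)` with `w(a_j) ≤ L_j` for
all `j`. -/
theorem exists_eq_faceSet (hh : ∀ j, 0 < h (ratCol A j)) (hε : 0 < ε)
    (hl : ∀ j, 0 < hypForm h ε (ratCol A j, L j)) {F : Set (ProjSpace d)}
    (hF : F ∈ umbrella A hA L h ε) :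
    ∃ w : (Fin d → ℚ) →ₗ[ℚ] ℚ, (∀ j, w (ratCol A j) ≤ L j) ∧ F = faceSet A hA L h ε w := by
  obtain ⟨⟨hFsub, hexp⟩, hoF⟩ := hF
  rcases F.eq_empty_or_nonempty with rfl | ⟨p₀, hp₀⟩
  · -- a large negative multiple of `h` is strictly below all `L_j`
    set N : ℚ := ∑ j, (|L j| + 1) / h (ratCol A j) with hN
    have hlt : ∀ j, (-(N • h)) (ratCol A j) < L j := fun j => by
      have h1 : (|L j| + 1) / h (ratCol A j) ≤ N :=
        Finset.single_le_sum (f := fun j => (|L j| + 1) / h (ratCol A j))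
          (fun k _ => div_nonneg (by positivity) (hh k).le) (Finset.mem_univ j)
      rw [div_le_iff₀ (hh j)] at h1
      have h2 := neg_abs_le (L j)
      simp only [LinearMap.neg_apply, LinearMap.smul_apply, smul_eq_mul]
      linarith
    refine ⟨-(N • h), fun j => (hlt j).le, (Set.eq_empty_of_forall_notMem ?_).symm⟩
    rintro p ⟨hp, hp0⟩
    obtain ⟨r, c, hr, hc, hx⟩ := exists_eq_sum_of_mem_polyhedron hε hl hp
    rw [← affineForm_chart_eq_zero_iff _ hp.1, hx, affineForm_sum] at hp0
    have hnn : ∀ j ∈ Finset.univ, 0 ≤ c j * (L j - (-(N • h)) (ratCol A j)) := fun j _ =>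
      mul_nonneg (hc j) (sub_nonneg.2 (hlt j).le)
    have hsum := Finset.sum_nonneg hnn
    have hr0 : r = 0 := by linarith
    have hc0 : ∀ j, c j = 0 := fun j => by
      have h1 := (Finset.sum_eq_zero_iff_of_nonneg hnn).1 (by linarith) j (Finset.mem_univ j)
      exact (mul_eq_zero.1 h1).resolve_right (sub_pos.2 (hlt j)).ne'
    have h1 := apply_chart _ hp.1
    rw [hx] at h1
    simp [hr0, hc0] at h1
  · obtain ⟨φ, hφ⟩ := hexp ⟨_, p₀, hp₀, rfl⟩
    set l := hypForm h ε with hl_def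
    -- the difference between the maximum of the exposing functional and the functional
    let ψ : HomCoord d →ₗ[ℚ] ℚ := φ (chart l p₀) • l - φ.toLinearMap
    have hψ : ∀ p ∈ polyhedron A hA L h ε,
        ψ (chart l p) = φ (chart l p₀) - φ (chart l p) := fun p hp => by
      simp [ψ, apply_chart l hp.1]
    have hmem₀ : chart l p₀ ∈ chart l '' F := ⟨p₀, hp₀, rfl⟩
    rw [hφ] at hmem₀
    have hnn : ∀ p ∈ polyhedron A hA L h ε, 0 ≤ ψ (chart l p) := fun p hp => by
      rw [hψ p hp]
      exact sub_nonneg.2 (hmem₀.2 _ ⟨p, hp, rfl⟩)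
    have hFiff : ∀ p ∈ polyhedron A hA L h ε, p ∈ F ↔ ψ (chart l p) = 0 := by
      intro p hp
      constructor
      · intro hpF
        have h1 : chart l p ∈ chart l '' F := ⟨p, hpF, rfl⟩
        rw [hφ] at h1
        refine le_antisymm ?_ (hnn p hp)
        rw [hψ p hp]
        exact sub_nonpos.2 (h1.2 _ ⟨p₀, hFsub hp₀, rfl⟩)
      · intro h0
        have h1 : chart l p ∈ chart l '' F := by
          rw [hφ]
          refine ⟨⟨p, hp, rfl⟩, fun y hy => (hmem₀.2 y hy).trans ?_⟩
          rw [hψ p hp] at h0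
          exact (sub_eq_zero.1 h0).le
        obtain ⟨q, hq, hqp⟩ := h1
        rwa [← chart_injOn l (hFsub hq).1 hp.1 hqp]
    have hsub := subset_polyhedron (hA := hA) hε hl
    have ho : 0 < ψ (0, 1) := by
      have h1 := hnn _ (hsub (Set.mem_insert _ _))
      have h2 := mt (hFiff _ (hsub (Set.mem_insert _ _))).2 hoF
      rw [origin, chart_mk, map_smul, smul_eq_mul] at h1 h2
      have h3 : 0 < (l (0, 1))⁻¹ := by simp [hl_def, hypForm, hε]
      exact pos_of_mul_pos_right (lt_of_le_of_ne h1 (Ne.symm h2)) h3.le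
    obtain ⟨w, hw⟩ := exists_eq_mul_affineForm ψ ho.ne'
    refine ⟨w, fun j => ?_, ?_⟩
    · have h1 := hnn _ (hsub (Set.mem_insert_of_mem _ ⟨j, rfl⟩))
      rw [colPoint, chart_mk, map_smul, smul_eq_mul, hw] at h1
      have h2 := nonneg_of_mul_nonneg_right h1 (inv_pos.2 (hl j))
      exact sub_nonneg.1 (nonneg_of_mul_nonneg_right h2 ho)
    · ext p
      constructor
      · intro hp
        have h1 := (hFiff p (hFsub hp)).1 hp
        rw [hw] at h1
        exact ⟨hFsub hp, (affineForm_chart_eq_zero_iff w (hFsub hp).1).1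
          ((mul_eq_zero.1 h1).resolve_left ho.ne')⟩
      · rintro ⟨hp, h0⟩
        rw [hFiff p hp, hw, (affineForm_chart_eq_zero_iff w hp.1).2 h0, mul_zero]

theorem mem_faceCols {F : Set (ProjSpace d)} {j : Fin n} :
    j ∈ faceCols A hA L F ↔ colPoint A hA L j ∈ F := by
  simp [faceCols]

theorem mem_faceCols_faceSet (hε : 0 < ε) (hl : ∀ j, 0 < hypForm h ε (ratCol A j, L j))
    (w : (Fin d → ℚ) →ₗ[ℚ] ℚ) (j : Fin n) :
    j ∈ faceCols A hA L (faceSet A hA L h ε w) ↔ w (ratCol A j) = L j := by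
  have hp := subset_polyhedron (hA := hA) hε hl (Set.mem_insert_of_mem _ ⟨j, rfl⟩)
  have h1 : affineForm w (colPoint A hA L j).rep = 0 ↔ w (ratCol A j) = L j := by
    rw [colPoint, apply_rep_mk_eq_zero_iff, affineForm_apply, sub_eq_zero, eq_comm]
  rw [mem_faceCols, ← h1]
  exact ⟨fun h => h.2, fun h => ⟨hp, h⟩⟩

theorem supports_faceCols_faceSet (hε : 0 < ε) (hl : ∀ j, 0 < hypForm h ε (ratCol A j, L j))
    {w : (Fin d → ℚ) →ₗ[ℚ] ℚ} (hw : ∀ j, w (ratCol A j) ≤ L j) :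
    Supports A L w (faceCols A hA L (faceSet A hA L h ε w)) where
  eq j hj := (mem_faceCols_faceSet hε hl w j).1 hj
  lt j hj := lt_of_le_of_ne (hw j) (mt (mem_faceCols_faceSet hε hl w j).2 hj)

theorem exists_mem_umbrella_of_supports (hε : 0 < ε)
    (hl : ∀ j, 0 < hypForm h ε (ratCol A j, L j)) {w : (Fin d → ℚ) →ₗ[ℚ] ℚ} {τ : Finset (Fin n)}
    (hw : Supports A L w τ) : ∃ F ∈ umbrella A hA L h ε, faceCols A hA L F = τ :=
  ⟨faceSet A hA L h ε w, faceSet_mem_umbrella hε hl hw.le, Finset.ext fun j => by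
    rw [mem_faceCols_faceSet hε hl, hw.mem_iff]⟩

theorem exists_supports_of_mem_umbrella (hh : ∀ j, 0 < h (ratCol A j)) (hε : 0 < ε)
    (hl : ∀ j, 0 < hypForm h ε (ratCol A j, L j)) {F : Set (ProjSpace d)}
    (hF : F ∈ umbrella A hA L h ε) : ∃ w, Supports A L w (faceCols A hA L F) := by
  obtain ⟨w, hw, rfl⟩ := exists_eq_faceSet hh hε hl hF
  exact ⟨w, supports_faceCols_faceSet hε hl hw⟩

/-- A face of the umbrella is the convex hull of the `a_j^L` on it, so that inclusion of faces is
inclusion of index sets. -/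
theorem subset_iff_faceCols_subset (hh : ∀ j, 0 < h (ratCol A j)) (hε : 0 < ε)
    (hl : ∀ j, 0 < hypForm h ε (ratCol A j, L j)) {F F' : Set (ProjSpace d)}
    (hF : F ∈ umbrella A hA L h ε) (hF' : F' ∈ umbrella A hA L h ε) :
    F' ⊆ F ↔ faceCols A hA L F' ⊆ faceCols A hA L F := by
  constructor
  · intro hsub j hj
    exact mem_faceCols.2 (hsub (mem_faceCols.1 hj))
  · obtain ⟨w, hw, rfl⟩ := exists_eq_faceSet hh hε hl hF
    obtain ⟨w', hw', rfl⟩ := exists_eq_faceSet hh hε hl hF'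
    rintro hsub p ⟨hp, hp0⟩
    obtain ⟨r, c, hr, hc, hx⟩ := exists_eq_sum_of_mem_polyhedron hε hl hp
    rw [← affineForm_chart_eq_zero_iff _ hp.1, hx, affineForm_sum] at hp0
    have hnn : ∀ j ∈ Finset.univ, 0 ≤ c j * (L j - w' (ratCol A j)) := fun j _ =>
      mul_nonneg (hc j) (sub_nonneg.2 (hw' j))
    have hsum := Finset.sum_nonneg hnn
    refine ⟨hp, ?_⟩
    rw [← affineForm_chart_eq_zero_iff _ hp.1, hx, affineForm_sum]
    have hr0 : r = 0 := by linarith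
    rw [hr0, zero_add]
    refine Finset.sum_eq_zero fun j _ => ?_
    have h1 := (Finset.sum_eq_zero_iff_of_nonneg hnn).1 (by linarith) j (Finset.mem_univ j)
    rcases mul_eq_zero.1 h1 with h2 | h2
    · rw [h2, zero_mul]
    · have h3 := hsub ((mem_faceCols_faceSet hε hl w' j).2 (sub_eq_zero.1 h2).symm)
      rw [(mem_faceCols_faceSet hε hl w j).1 h3, sub_self, mul_zero]

end Faces

end GKZ

end

theorem mainTheorem4 {d n : ℕ} (A : Matrix (Fin d) (Fin n) ℤ)
    (hA : ∀ j, A.col j ≠ 0)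
    (hZ : AddSubgroup.closure (Set.range A.col) = ⊤)
    (hpos : ∀ v ∈ AddSubmonoid.closure (Set.range A.col),
      -v ∈ AddSubmonoid.closure (Set.range A.col) → v = 0)
    (L : Fin n → ℚ)
    (h : (Fin d → ℚ) →ₗ[ℚ] ℚ) (hh : ∀ j, 0 < h (GKZ.ratCol A j))
    (ε : ℚ) (hε : 0 < ε) (hεL : ∀ j, L j ≠ 0 → ε < |h (GKZ.ratCol A j) / L j|) :
    -- the graded primes containing the graded toric ideal
    {P : Ideal (MvPolynomial (Fin n) ℂ) | P.IsPrime ∧ GKZ.IsGradedIdeal A P ∧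
        GKZ.gradedIdeal L (GKZ.toricIdeal A) ≤ P} =
      {P | ∃ F ∈ GKZ.umbrella A hA L h ε, P = GKZ.faceIdeal A (GKZ.faceCols A hA L F)} ∧
    -- `Spec(S_A^L) = Var(I_A^L)`, as subschemes of `Spec(R)` and as sets of points
    (Function.Surjective (GKZ.toGradedToricRing A L) ∧
      RingHom.ker (GKZ.toGradedToricRing A L) = GKZ.gradedIdeal L (GKZ.toricIdeal A)) ∧
    GKZ.specPoints A L = MvPolynomial.zeroLocus ℂ (GKZ.gradedIdeal L (GKZ.toricIdeal A)) ∧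
    -- the union of the closures of the facet orbits
    GKZ.specPoints A L = ⋃ F ∈ GKZ.umbrellaDim A hA L h ε ((d : ℤ) - 1),
      GKZ.zariskiClosure (GKZ.orbit A (GKZ.faceCols A hA L F)) ∧
    -- the disjoint union of the orbits
    GKZ.specPoints A L = ⋃ F ∈ GKZ.umbrella A hA L h ε, GKZ.orbit A (GKZ.faceCols A hA L F) ∧
    (GKZ.umbrella A hA L h ε).PairwiseDisjoint
      (fun F => GKZ.orbit A (GKZ.faceCols A hA L F)) ∧
    -- adjacency of orbits is inclusion of faces, equivalently of their index sets
    ∀ F' ∈ GKZ.umbrella A hA L h ε, ∀ F ∈ GKZ.umbrella A hA L h ε,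
      (GKZ.orbit A (GKZ.faceCols A hA L F') ⊆
          GKZ.zariskiClosure (GKZ.orbit A (GKZ.faceCols A hA L F)) ↔ F' ⊆ F) ∧
      (F' ⊆ F ↔ GKZ.faceCols A hA L F' ⊆ GKZ.faceCols A hA L F) := by
  have hl := GKZ.hypForm_ratCol_pos hh hε hεL
  have hsupp : ∀ F ∈ GKZ.umbrella A hA L h ε, ∃ w, GKZ.Supports A L w (GKZ.faceCols A hA L F) :=
    fun F hF => GKZ.exists_supports_of_mem_umbrella hh hε hl hF
  have hspec := GKZ.specPoints_eq_zeroLocus A L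
  have hface : ∀ {w τ}, GKZ.Supports A L w τ →
      ∃ F ∈ GKZ.umbrella A hA L h ε, GKZ.faceCols A hA L F = τ :=
    fun hw => GKZ.exists_mem_umbrella_of_supports hε hl hw
  refine ⟨?_, ⟨GKZ.toGradedToricRing_surjective A L, GKZ.ker_toGradedToricRing A L⟩, hspec,
    ?_, ?_, ?_, ?_⟩
  · ext P
    refine GKZ.isPrime_and_isGradedIdeal_and_le_iff.trans ⟨?_, ?_⟩
    · rintro ⟨w, τ, hw, rfl⟩
      obtain ⟨F, hF, rfl⟩ := hface hw
      exact ⟨F, hF, rfl⟩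
    · rintro ⟨F, hF, rfl⟩
      obtain ⟨w, hw⟩ := hsupp F hF
      exact ⟨w, _, hw, rfl⟩
  · rw [hspec]
    refine Set.Subset.antisymm (fun ξ hξ => ?_) (Set.iUnion₂_subset fun F hF => ?_)
    · obtain ⟨w', τ', hw', hξτ⟩ := GKZ.exists_supports_of_mem_zeroLocus hξ
      obtain ⟨w, τ, hw, hsub, hdim⟩ := hw'.exists_facet hZ
      obtain ⟨F, hF, rfl⟩ := hface hw
      exact Set.mem_iUnion₂.2 ⟨F, ⟨hF, hdim⟩, (hw.orbit_subset_zariskiClosure_iff hw').2 hsub hξτ⟩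
    · obtain ⟨w, hw⟩ := hsupp F hF.1
      exact hw.zariskiClosure_orbit_subset
  · rw [hspec]
    refine Set.Subset.antisymm (fun ξ hξ => ?_) (Set.iUnion₂_subset fun F hF => ?_)
    · obtain ⟨w, τ, hw, hξτ⟩ := GKZ.exists_supports_of_mem_zeroLocus hξ
      obtain ⟨F, hF, rfl⟩ := hface hw
      exact Set.mem_iUnion₂.2 ⟨F, hF, hξτ⟩
    · obtain ⟨w, hw⟩ := hsupp F hF
      exact (GKZ.subset_zariskiClosure _).trans hw.zariskiClosure_orbit_subset
  · intro F hF F' hF' hne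
    refine Set.disjoint_left.2 fun ξ hξ hξ' => hne ?_
    -- a point of both orbits has both index sets as its support
    have heq : GKZ.faceCols A hA L F = GKZ.faceCols A hA L F' := Finset.ext fun j => by
      rw [← GKZ.ne_zero_iff_of_mem_orbit hξ, GKZ.ne_zero_iff_of_mem_orbit hξ']
    exact Set.Subset.antisymm ((GKZ.subset_iff_faceCols_subset hh hε hl hF' hF).2 heq.le)
      ((GKZ.subset_iff_faceCols_subset hh hε hl hF hF').2 heq.ge)
  · intro F' hF' F hF
    obtain ⟨w', hw'⟩ := hsupp F' hF'
    obtain ⟨w, hw⟩ := hsupp F hF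
    have hiff := GKZ.subset_iff_faceCols_subset hh hε hl hF hF'
    exact ⟨(hw.orbit_subset_zariskiClosure_iff hw').trans hiff.symm, hiff⟩
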